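/- Consider $n$ controllers and a horizon $T$. The state satisfies $X_{t+1}=AX_t+BU_t+W_t$ for $t=1,\dots,T-1$, where $U_t=\mathrm{vec}(U^1_t,\dots,U^n_t)$, and controller $i$ observes the $i$-th block $Y^i_t=C^iX_t+V^i_t$ of $Y_t=CX_t+V_t$ for $t=1,\dots,T$. The vectors $X_1\sim\mathcal N(0,\Sigma_x)$, $W_t\sim\mathcal N(0,\Sigma_w)$ $(1\le t\le T-1)$ and $V_t\sim\mathcal N(0,\Sigma_v)$ $(1\le t\le T)$ are mutually independent. Write $B=[B^1\ \cdots\ B^n]$ and $N=[N^1\ \cdots\ N^n]$ in blocks. The cost of a strategy profile is $\mathcal J=\mathrm E\sum_{t=1}^T (MX_t+NU_t)^{\mathsf T}(MX_t+NU_t)\in[0,\infty]$. Assume that every controller can substitute for the others in open loop: for every $u$ and every $i$ there is $v^i$ with $Bu=B^iv^i$ and $Nu=N^iv^i$. Let $\Lambda^i=\begin{bmatrix}B^i\\N^i\end{bmatrix}^{\dagger}\begin{bmatrix}B\\N\end{bmatrix}$, where $\dagger$ is the Moore-Penrose pseudo-inverse. Let $P_1=\Sigma_x$, $L_t=P_tC^{\mathsf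 T}(CP_tC^{\mathsf T}+\Sigma_v)^{-1}$, $\Sigma_t=(I-L_tC)P_t$, $P_{t+1}=A\Sigma_tA^{\mathsf T}+\Sigma_w$, where the inverted matrices are assumed invertible for $t=1,\dots,T$. Define $Z_1=L_1Y_1$, $Z_{t+1}=(I-L_{t+1}C)(AZ_t+BU_t)+L_{t+1}Y_{t+1}$ and, with $L_t=[L^1_t\ \cdots\ L^n_t]$, define $S^i_1=L^i_1Y^i_1$, $S^i_{t+1}=(I-L_{t+1}C)(AS^i_t+B^iU^i_t)+L^i_{t+1}Y^i_{t+1}$. An information structure assigns to controller $i$ at time $t$ a collection $\hat I^i_t$ of observations and actions; a strategy of controller $i$ is $U^i_t=g^i_t(\hat I^i_t)$ with $g^i_t$ measurable, and a strategy profile is optimal if it minimizes $\mathcal J$ among all such profiles. The centralized information structure gives $\tilde I_t=\{Y_{1:t},U_{1:t-1}\}$ to every controller. Let $\hat I$ be any information structure with $$\{Y^i_{1:t},U^i_{1:t-1}\}\subseteq \hat I^i_t\subseteq\{Y_{1:t},U_{1:t-1}\}\qquad\text{for all } i=1,\dots,n,\ t=1,\dots,T.$$ Then: 1. there are gain matrices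 $K_t$ such that $U_t=K_tZ_t$ is optimal for the centralized information structure; 2. for all gain matrices $K_t$, under the strategy $U_t=K_tZ_t$ one has $Z_t=\mathrm E(X_t\mid \tilde I_t)$ almost surely for $t=1,\dots,T$; 3. whenever $U_t=K_tZ_t$ is optimal for the centralized information structure, the strategies $U^i_t=\Lambda^iK_tS^i_t$, $i=1,\dots,n$, are optimal for the information structure $\hat I$, and their expected cost equals the optimal centralized cost. -/

import Mathlib

open MeasureTheory ProbabilityTheory Matrix

/-- `G` is a Moore-Penrose pseudo-inverse of the real matrix `A`. -/
structure IsMoorePenrose {m n : Type*} [Fintype m] [Fintype n]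
    (A : Matrix m n ℝ) (G : Matrix n m ℝ) : Prop where
  mul_mul_left : A * G * A = A
  mul_mul_right : G * A * G = G
  symm_left : (A * G)ᵀ = A * G
  symm_right : (G * A)ᵀ = G * A

theorem IsMoorePenrose.unique {m n : Type*} [Fintype m] [Fintype n]
    {A : Matrix m n ℝ} {G H : Matrix n m ℝ} (hG : IsMoorePenrose A G)
    (hH : IsMoorePenrose A H) : G = H := by
  have h1 : A * G = A * H := by
    calc A * G = (A * H) * (A * G) := by
          rw [← Matrix.mul_assoc, hH.mul_mul_left]
      _ = (A * H)ᵀ * (A * G)ᵀ := by rw [hH.symm_left, hG.symm_left]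
      _ = ((A * G) * (A * H))ᵀ := by rw [Matrix.transpose_mul (A * G)]
      _ = (A * H)ᵀ := by rw [← Matrix.mul_assoc, hG.mul_mul_left]
      _ = A * H := hH.symm_left
  have h2 : G * A = H * A := by
    calc G * A = (G * A) * (H * A) := by
          rw [Matrix.mul_assoc, ← Matrix.mul_assoc A, hH.mul_mul_left]
      _ = (G * A)ᵀ * (H * A)ᵀ := by rw [hG.symm_right, hH.symm_right]
      _ = ((H * A) * (G * A))ᵀ := by rw [Matrix.transpose_mul (H * A)]
      _ = (H * A)ᵀ := by rw [Matrix.mul_assoc, ← Matrix.mul_assoc A, hG.mul_mul_left]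
      _ = H * A := hH.symm_right
  calc G = G * A * G := hG.mul_mul_right.symm
    _ = H * A * H := by rw [h2, Matrix.mul_assoc, h1, ← Matrix.mul_assoc]
    _ = H := hH.mul_mul_right

theorem exists_isMoorePenrose {m n : Type*} [Fintype m] [Fintype n]
    (A : Matrix m n ℝ) : ∃ G, IsMoorePenrose A G := by
  classical
  have hH : (Aᵀ * A).IsHermitian := by
    simpa [Matrix.conjTranspose_eq_transpose_of_trivial] using
      Matrix.isHermitian_conjTranspose_mul_self A
  obtain ⟨U, d, hU, hd⟩ : ∃ (U : Matrix n n ℝ) (d : n → ℝ), Uᵀ * U = 1 ∧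
      Aᵀ * A = U * diagonal d * Uᵀ := by
    refine ⟨hH.eigenvectorUnitary, hH.eigenvalues, ?_, ?_⟩
    · have := Unitary.coe_star_mul_self hH.eigenvectorUnitary
      simpa [Matrix.star_eq_conjTranspose,
        Matrix.conjTranspose_eq_transpose_of_trivial] using this
    · have := hH.spectral_theorem
      rw [Unitary.conjStarAlgAut_apply] at this
      simpa [Matrix.star_eq_conjTranspose,
        Matrix.conjTranspose_eq_transpose_of_trivial, Function.comp_def] using this
  set H := Aᵀ * A with hHdef
  set Q := U * diagonal (fun i => (d i)⁻¹) * Uᵀ with hQ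
  have key : ∀ a b : n → ℝ, (U * diagonal a * Uᵀ) * (U * diagonal b * Uᵀ)
      = U * diagonal (fun i => a i * b i) * Uᵀ := by
    intro a b
    calc (U * diagonal a * Uᵀ) * (U * diagonal b * Uᵀ)
        = U * diagonal a * (Uᵀ * U) * (diagonal b * Uᵀ) := by simp only [Matrix.mul_assoc]
      _ = U * (diagonal a * diagonal b) * Uᵀ := by
          rw [hU, Matrix.mul_one]; simp only [Matrix.mul_assoc]
      _ = _ := by rw [diagonal_mul_diagonal]
  have hsym : ∀ a : n → ℝ, (U * diagonal a * Uᵀ)ᵀ = U * diagonal a * Uᵀ := by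
    intro a
    simp [Matrix.transpose_mul, Matrix.mul_assoc]
  have hQH : Q * H = U * diagonal (fun i => (d i)⁻¹ * d i) * Uᵀ := by rw [hd, hQ, key]
  have hHQH : H * (Q * H) = H := by
    rw [hQH, hd, key]
    congr 3; ext i
    by_cases h : d i = 0 <;> simp [h]
  have hQHQ : Q * H * Q = Q := by
    rw [hQH, hQ, key]
    congr 3; ext i
    by_cases h : d i = 0 <;> simp [h]
  have hQHs : (Q * H)ᵀ = Q * H := by rw [hQH, hsym]
  have hAQH : A * (Q * H) = A := by
    have h0 : (A * (Q * H) - A)ᴴ * (A * (Q * H) - A) = 0 := by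
      rw [Matrix.conjTranspose_eq_transpose_of_trivial, Matrix.transpose_sub,
        Matrix.transpose_mul, hQHs, Matrix.sub_mul]
      have h1 : Aᵀ * (A * (Q * H) - A) = 0 := by
        rw [Matrix.mul_sub, ← Matrix.mul_assoc, ← hHdef, hHQH, sub_self]
      rw [Matrix.mul_assoc, h1]; simp
    exact sub_eq_zero.1 (Matrix.conjTranspose_mul_self_eq_zero.1 h0)
  refine ⟨Q * Aᵀ, ?_, ?_, ?_, ?_⟩
  · rw [Matrix.mul_assoc, Matrix.mul_assoc Q, ← hHdef, hAQH]
  · rw [Matrix.mul_assoc Q, ← hHdef, ← Matrix.mul_assoc, hQHQ]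
  · rw [Matrix.transpose_mul, Matrix.transpose_mul, Matrix.transpose_transpose, hQ, hsym,
      Matrix.mul_assoc]
  · rw [Matrix.mul_assoc, ← hHdef, hQHs]

/-- The Moore-Penrose pseudo-inverse of a real matrix. -/
noncomputable def pinv {m n : Type*} [Fintype m] [Fintype n] (A : Matrix m n ℝ) :
    Matrix n m ℝ :=
  (exists_isMoorePenrose A).choose

theorem pinv_spec {m n : Type*} [Fintype m] [Fintype n] (A : Matrix m n ℝ) :
    IsMoorePenrose A (pinv A) :=
  (exists_isMoorePenrose A).choose_spec

/-- The centred Gaussian law `𝒩(0, S)` on `ℝ^ι`, for a positive semidefinite `S`. -/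
noncomputable def gaussianVec {ι : Type*} [Fintype ι] [DecidableEq ι] (S : Matrix ι ι ℝ) :
    Measure (ι → ℝ) :=
  (multivariateGaussian 0 S).map WithLp.ofLp

/-- The data of the `n`-controller LQG model with output feedback. The vectors
`u = vec(u¹, …, uⁿ)` and `y = vec(y¹, …, yⁿ)` are indexed by pairs `⟨i, k⟩`, the `k`-th entry
of the `i`-th block. Time runs over `t = 0, …, T - 1`. -/
structure LQGModel where
  /-- number of controllers -/
  n : ℕ
  /-- horizon -/
  T : ℕ
  /-- dimension of the state -/
  dx : ℕ
  /-- number of rows of `M` and `N` -/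
  dc : ℕ
  /-- dimension of the action of each controller -/
  du : Fin n → ℕ
  /-- dimension of the observation of each controller -/
  dy : Fin n → ℕ
  A : Matrix (Fin dx) (Fin dx) ℝ
  B : Matrix (Fin dx) (Σ i, Fin (du i)) ℝ
  M : Matrix (Fin dc) (Fin dx) ℝ
  N : Matrix (Fin dc) (Σ i, Fin (du i)) ℝ
  C : Matrix (Σ i, Fin (dy i)) (Fin dx) ℝ
  /-- covariance of the initial state -/
  Sx : Matrix (Fin dx) (Fin dx) ℝ
  /-- covariance of the process noise -/
  Sw : Matrix (Fin dx) (Fin dx) ℝ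
  /-- covariance of the observation noise -/
  Sv : Matrix (Σ i, Fin (dy i)) (Σ i, Fin (dy i)) ℝ
  Sx_psd : Sx.PosSemidef
  Sw_psd : Sw.PosSemidef
  Sv_psd : Sv.PosSemidef

namespace LQGModel

/-- `vec(v¹, …, vⁿ)`. -/
def vec {n : ℕ} {d : Fin n → ℕ} (v : ∀ i, Fin (d i) → ℝ) : (Σ i, Fin (d i)) → ℝ :=
  fun p => v p.1 p.2

/-- The `i`-th block `v^i` of `v = vec(v¹, …, vⁿ)`. -/
def blk {n : ℕ} {d : Fin n → ℕ} (v : (Σ i, Fin (d i)) → ℝ) (i : Fin n) : Fin (d i) → ℝ :=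
  fun k => v ⟨i, k⟩

/-- The `i`-th column block `Q^i` of `Q = [Q¹ … Qⁿ]`. -/
def colBlk {n r : ℕ} {d : Fin n → ℕ} (Q : Matrix (Fin r) (Σ i, Fin (d i)) ℝ) (i : Fin n) :
    Matrix (Fin r) (Fin (d i)) ℝ :=
  Q.submatrix id fun k => ⟨i, k⟩

variable (m : LQGModel)

/-- Each controller can substitute for all the others in open-loop control: for every `u` and `i`
there is `v^i` with `B u = B vec(0, …, v^i, …, 0)` and `N u = N vec(0, …, v^i, …, 0)`. -/
def Substitutable : Prop :=
  ∀ (i : Fin m.n) (u : (Σ j, Fin (m.du j)) → ℝ), ∃ v : Fin (m.du i) → ℝ,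
    m.B *ᵥ u = m.B *ᵥ vec (Pi.single i v) ∧ m.N *ᵥ u = m.N *ᵥ vec (Pi.single i v)

/-- `Λ^i = [B^i; N^i]^† [B; N]`. -/
noncomputable def Lam (i : Fin m.n) : Matrix (Fin (m.du i)) (Σ j, Fin (m.du j)) ℝ :=
  pinv (Matrix.fromRows (colBlk m.B i) (colBlk m.N i)) * Matrix.fromRows m.B m.N

/-! ### Information and strategies -/

/-- Names of the variables that may be observed: `obs i t` stands for `Y^i_t` and `act i t`
for `U^i_t`. -/
inductive Var (n : ℕ) : Type
  | obs (i : Fin n) (t : ℕ)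
  | act (i : Fin n) (t : ℕ)

/-- The dimension of a variable. -/
abbrev dim : Var m.n → ℕ
  | .obs i _ => m.dy i
  | .act i _ => m.du i

/-- An assignment of values to all variables. -/
abbrev Record : Type := ∀ ℓ : Var m.n, Fin (m.dim ℓ) → ℝ

/-- An information structure: the collection of variables available to controller `i` at
time `t`. -/
abbrev InfoStructure : Type := Fin m.n → ℕ → Set (Var m.n)

/-- The own history `{Y^i_s : s ≤ t} ∪ {U^i_s : s < t}` of each controller `i`. -/
def ownInfo : m.InfoStructure := fun i t =>
  {ℓ | (∃ s ≤ t, ℓ = Var.obs i s) ∨ (∃ s < t, ℓ = Var.act i s)}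

/-- The full history `{Y_s : s ≤ t} ∪ {U_s : s < t}` of all controllers. -/
def fullHistory (t : ℕ) : Set (Var m.n) :=
  {ℓ | (∃ j, ∃ s ≤ t, ℓ = Var.obs j s) ∨ (∃ j, ∃ s < t, ℓ = Var.act j s)}

/-- The centralized information structure: every controller knows the full history. -/
def centralInfo : m.InfoStructure := fun _ t => m.fullHistory t

/-- A profile of strategies; `g i t` is the control law of controller `i` at time `t`. -/
abbrev Strategy : Type := ∀ (i : Fin m.n), ℕ → m.Record → Fin (m.du i) → ℝ

/-- The control laws are (Borel) functions of the available information only: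
`U^i_t = g^i_t(I^i_t)`. -/
def Admissible (I : m.InfoStructure) (g : m.Strategy) : Prop :=
  ∀ i, ∀ t < m.T, Measurable (g i t) ∧ DependsOn (g i t) (I i t)

/-! ### Closed loop -/

/-- The state `X_t` and the record of the variables `Y_s` (`s ≤ t`) and `U_s` (`s < t`) realized
under the strategies `g`, for given initial state and noise sequences. The entries of the record
for variables not yet realized are `0`. -/
noncomputable def run (g : m.Strategy) (x₁ : Fin m.dx → ℝ) (w : ℕ → Fin m.dx → ℝ)
    (v : ℕ → (Σ i, Fin (m.dy i)) → ℝ) : ℕ → (Fin m.dx → ℝ) × m.Record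
  | 0 => (x₁, fun ℓ => match ℓ with
      | .obs i s => if s = 0 then blk (m.C *ᵥ x₁ + v 0) i else 0
      | .act _ _ => 0)
  | t + 1 =>
    let x := (run g x₁ w v t).1
    let ρ := (run g x₁ w v t).2
    let u : ∀ i, Fin (m.du i) → ℝ := fun i => g i t ρ
    let x' := m.A *ᵥ x + m.B *ᵥ vec u + w t
    (x', fun ℓ => match ℓ with
      | .obs i s => if s = t + 1 then blk (m.C *ᵥ x' + v (t + 1)) i else ρ (.obs i s)
      | .act i s => if s = t then u i else ρ (.act i s))

section Processes

variable {Ω : Type*} (X₁ : Ω → Fin m.dx → ℝ) (W : ℕ → Ω → Fin m.dx → ℝ)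
  (V : ℕ → Ω → (Σ i, Fin (m.dy i)) → ℝ) (g : m.Strategy)

/-- The state process. -/
noncomputable def X (t : ℕ) (ω : Ω) : Fin m.dx → ℝ :=
  (m.run g (X₁ ω) (fun s => W s ω) (fun s => V s ω) t).1

/-- The record at time `t`, which contains `Y_{1:t}` and `U_{1:t-1}`. -/
noncomputable def record (t : ℕ) (ω : Ω) : m.Record :=
  (m.run g (X₁ ω) (fun s => W s ω) (fun s => V s ω) t).2

/-- The action process `U_t = vec(U¹_t, …, Uⁿ_t)`. -/
noncomputable def U (t : ℕ) (ω : Ω) : (Σ i, Fin (m.du i)) → ℝ :=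
  vec fun i => g i t (m.record X₁ W V g t ω)

/-- The sigma-algebra generated by `Y_{1:t}` and `U_{1:t-1}`. -/
noncomputable abbrev centralSigma (t : ℕ) : MeasurableSpace Ω :=
  ⨆ ℓ ∈ m.fullHistory t, MeasurableSpace.comap (fun ω => m.record X₁ W V g t ω ℓ) inferInstance

variable [MeasurableSpace Ω] (P : Measure Ω)

/-- The expected total cost `E ∑_t (M X_t + N U_t)ᵀ (M X_t + N U_t)`, in `[0, ∞]`. -/
noncomputable def cost : ENNReal :=
  ∫⁻ ω, ENNReal.ofReal (∑ t ∈ Finset.range m.T,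
    (m.M *ᵥ m.X X₁ W V g t ω + m.N *ᵥ m.U X₁ W V g t ω) ⬝ᵥ
      (m.M *ᵥ m.X X₁ W V g t ω + m.N *ᵥ m.U X₁ W V g t ω)) ∂P

/-- `g` minimizes the expected cost among the strategies admissible for `I`. -/
def IsOptimal (I : m.InfoStructure) : Prop :=
  m.Admissible I g ∧
    ∀ g' : m.Strategy, m.Admissible I g' → m.cost X₁ W V g P ≤ m.cost X₁ W V g' P

/-- The initial state, the process noises and the observation noises within the horizon are
mutually independent, with laws `𝒩(0, Sx)`, `𝒩(0, Sw)`, `𝒩(0, Sv)`. -/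
structure IsNoise : Prop where
  measurable_init : Measurable X₁
  measurable_process : ∀ t, t + 1 < m.T → Measurable (W t)
  measurable_observation : ∀ t < m.T, Measurable (V t)
  law : P.map (fun ω => (X₁ ω, (fun t : Fin (m.T - 1) => W t ω), fun t : Fin m.T => V t ω)) =
    (gaussianVec m.Sx).prod
      ((Measure.pi fun _ => gaussianVec m.Sw).prod (Measure.pi fun _ => gaussianVec m.Sv))

end Processes

/-! ### The filter and the two strategies -/

/-- `C P Cᵀ + Σ_v`, for a prediction covariance `P`. -/
def innovCov (P : Matrix (Fin m.dx) (Fin m.dx) ℝ) :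
    Matrix (Σ i, Fin (m.dy i)) (Σ i, Fin (m.dy i)) ℝ :=
  m.C * P * m.Cᵀ + m.Sv

/-- `P Cᵀ (C P Cᵀ + Σ_v)⁻¹`, for a prediction covariance `P`. -/
noncomputable def gainOf (P : Matrix (Fin m.dx) (Fin m.dx) ℝ) :
    Matrix (Fin m.dx) (Σ i, Fin (m.dy i)) ℝ :=
  P * m.Cᵀ * (m.innovCov P)⁻¹

/-- The prediction covariances: `Σ_x` initially and then `A Σ_t Aᵀ + Σ_w`, where
`Σ_t = (I - L_t C) P_t`. -/
noncomputable def predCov : ℕ → Matrix (Fin m.dx) (Fin m.dx) ℝ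
  | 0 => m.Sx
  | t + 1 => m.A * ((1 - m.gainOf (predCov t) * m.C) * predCov t) * m.Aᵀ + m.Sw

/-- The filter gains `L_t`. -/
noncomputable def L (t : ℕ) : Matrix (Fin m.dx) (Σ i, Fin (m.dy i)) ℝ :=
  m.gainOf (m.predCov t)

/-- The centralized estimate `Z_t`, as a function of `Y_{1:t}` and `U_{1:t-1}`. -/
noncomputable def Z (ρ : m.Record) : ℕ → Fin m.dx → ℝ
  | 0 => m.L 0 *ᵥ vec (fun i => ρ (.obs i 0))
  | t + 1 =>
    (1 - m.L (t + 1) * m.C) *ᵥ (m.A *ᵥ Z ρ t + m.B *ᵥ vec (fun i => ρ (.act i t))) +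
      m.L (t + 1) *ᵥ vec (fun i => ρ (.obs i (t + 1)))

/-- The local statistic `S^i_t`, as a function of `Y^i_{1:t}` and `U^i_{1:t-1}`. -/
noncomputable def S (ρ : m.Record) (i : Fin m.n) : ℕ → Fin m.dx → ℝ
  | 0 => colBlk (m.L 0) i *ᵥ ρ (.obs i 0)
  | t + 1 =>
    (1 - m.L (t + 1) * m.C) *ᵥ (m.A *ᵥ S ρ i t + colBlk m.B i *ᵥ ρ (.act i t)) +
      colBlk (m.L (t + 1)) i *ᵥ ρ (.obs i (t + 1))

/-- A sequence of gain matrices. -/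
abbrev Gains : Type := ℕ → Matrix (Σ i, Fin (m.du i)) (Fin m.dx) ℝ

/-- The centralized strategy `U_t = K_t Z_t`. -/
noncomputable def centralStrategy (K : m.Gains) : m.Strategy :=
  fun i t ρ => blk (K t *ᵥ m.Z ρ t) i

/-- The decentralized strategy `U^i_t = Λ^i K_t S^i_t`. -/
noncomputable def localStrategy (K : m.Gains) : m.Strategy :=
  fun i t ρ => m.Lam i *ᵥ (K t *ᵥ m.S ρ i t)

end LQGModel

/-!
The proof separates estimation from control and then distributes the control law.

*Estimation.* The errors `X_t - Z_t` (`filtErr`) and the innovations (`innov`) are linear functions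
of the primitive noise in which no action appears (`X_eq_Zc_add`, `obs_eq`). The primitive noise is
Gaussian, hence so are all of them jointly, and independence is a matter of covariance matrices: the
choice of the gain makes the error at time `t` uncorrelated with the innovations up to time `t`
(`cov_filtErr_innov`), and the innovations uncorrelated with each other (`cov_innov_innov`). Under
any strategy, linear or not, the record at time `t` is a measurable function of the innovations up
to time `t` (`measurable_record`), so it is independent of the error. This yields
`Z_t = E(X_t | Ĩ_t)`.

*Control.* The same independence splits the expected stage cost into the cost of `(Z_t, U_t)` and a
term that no strategy influences (`lintegral_stage`), and `Z_{t+1}` is `A Z_t + B U_t` plus an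
independent multiple of the next innovation (`lintegral_Zc`). What is left is a fully observed
linear quadratic problem. No definiteness of `N` is assumed, so each step of its Riccati recursion
(`IsPSDForm.exists_riccati_step`) is a least squares problem solved by the pseudo-inverse. As
strategies need not have finite cost, the two splittings are proved in `[0, ∞]`, from the symmetry
of the Gaussian law and the parallelogram identity (`IsPSDForm.lintegral_add`) instead of from the
vanishing of integrals of products.

*Decentralization.* The statistics `S^i_t` add up to `Z_t` on every record (`sum_S`), and
substitutability means that `Λ^i u` of controller `i` acts on the state and on the cost as `u` does
(`Substitutable.colBlk_mulVec_Lam`). So `vec(Λ^i K_t S^i_t)` acts like `K_t Z_t`, and the two closed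
loops have the same state and the same cost in every realization (`localStrategy_eq`). Since
profiles admissible for `Î` are admissible for the centralized structure, the optimal centralized
cost bounds theirs from below.
-/

/-! ### Sums of squares of linear forms -/

/-- `q` is a positive semidefinite quadratic form, written as `q z = ‖F z‖²` for some real matrix
`F`. The number of rows of `F` is left free: the dynamic programming recursion increases it. -/
def IsPSDForm {ι : Type*} [Fintype ι] (q : (ι → ℝ) → ℝ) : Prop :=
  ∃ (κ : Type) (_ : Fintype κ) (F : Matrix κ ι ℝ), ∀ z, q z = (F *ᵥ z) ⬝ᵥ (F *ᵥ z)

namespace IsPSDForm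

variable {ι : Type*} [Fintype ι] {q : (ι → ℝ) → ℝ}

theorem zero : IsPSDForm (fun _ : ι → ℝ => 0) :=
  ⟨Empty, inferInstance, 0, fun z => by simp⟩

theorem dotProduct_self {k : ℕ} : IsPSDForm (fun z : Fin k → ℝ => z ⬝ᵥ z) :=
  ⟨Fin k, inferInstance, 1, fun z => by simp⟩

theorem nonneg (hq : IsPSDForm q) (z : ι → ℝ) : 0 ≤ q z := by
  obtain ⟨κ, _, F, hF⟩ := hq
  rw [hF]
  exact Finset.sum_nonneg fun i _ => mul_self_nonneg _

theorem measurable (hq : IsPSDForm q) : Measurable q := by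
  obtain ⟨κ, _, F, hF⟩ := hq
  rw [show q = fun z => (F *ᵥ z) ⬝ᵥ (F *ᵥ z) from funext hF]
  exact (by fun_prop : Continuous fun z => (F *ᵥ z) ⬝ᵥ (F *ᵥ z)).measurable

theorem parallelogram (hq : IsPSDForm q) (x y : ι → ℝ) :
    q (x + y) + q (x + -y) = (q x + q x) + (q y + q y) := by
  obtain ⟨κ, _, F, hF⟩ := hq
  simp only [hF, mulVec_add, mulVec_neg, dotProduct_add, add_dotProduct, dotProduct_neg,
    neg_dotProduct]
  ring

end IsPSDForm

/-- If `b` is independent of `a` and its law is invariant under `b ↦ -b`, then so is the joint law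
of `(a, b)`. -/
theorem ProbabilityTheory.IndepFun.map_prod_neg {Ω α : Type*} {ι : Type*} [MeasurableSpace Ω]
    [MeasurableSpace α] {P : Measure Ω} [IsProbabilityMeasure P] {a : Ω → α}
    {b : Ω → ι → ℝ} (ha : Measurable a) (hb : Measurable b) (h : IndepFun a b P)
    (hs : P.map (fun ω => -b ω) = P.map b) :
    P.map (fun ω => (a ω, -b ω)) = P.map fun ω => (a ω, b ω) := by
  have h2 : IndepFun a (fun ω => -b ω) P :=
    h.comp (φ := id) (ψ := fun x => -x) measurable_id (by fun_prop)
  rw [h2.map_prod_eq_prod_map_map ha.aemeasurable (by fun_prop),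
    h.map_prod_eq_prod_map_map ha.aemeasurable hb.aemeasurable, hs]

/-- Pythagoras' theorem in `[0, ∞]`, for `b` independent of `a` and symmetrically distributed. As
`a + b` and `a - b` have the same law, the parallelogram identity gives the claim with no moment
assumption on `a`. -/
theorem IsPSDForm.lintegral_add {Ω : Type*} {ι : Type*} [Fintype ι] [MeasurableSpace Ω]
    {P : Measure Ω} [IsProbabilityMeasure P] {q : (ι → ℝ) → ℝ} (hq : IsPSDForm q)
    {a b : Ω → ι → ℝ} (ha : Measurable a) (hb : Measurable b) (h : IndepFun a b P)
    (hs : P.map (fun ω => -b ω) = P.map b) :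
    ∫⁻ ω, ENNReal.ofReal (q (a ω + b ω)) ∂P =
      ∫⁻ ω, ENNReal.ofReal (q (a ω)) ∂P + ∫⁻ ω, ENNReal.ofReal (q (b ω)) ∂P := by
  have hqm := hq.measurable
  have hf : Measurable fun p : (ι → ℝ) × (ι → ℝ) => ENNReal.ofReal (q (p.1 + p.2)) := by fun_prop
  have h1 : ∫⁻ ω, ENNReal.ofReal (q (a ω + -b ω)) ∂P = ∫⁻ ω, ENNReal.ofReal (q (a ω + b ω)) ∂P := by
    rw [← lintegral_map (g := fun ω => (a ω, -b ω)) hf (by fun_prop),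
      ← lintegral_map (g := fun ω => (a ω, b ω)) hf (by fun_prop), h.map_prod_neg ha hb hs]
  have h2 : ∫⁻ ω, ENNReal.ofReal (q (a ω + b ω)) ∂P + ∫⁻ ω, ENNReal.ofReal (q (a ω + -b ω)) ∂P =
      (∫⁻ ω, ENNReal.ofReal (q (a ω)) ∂P + ∫⁻ ω, ENNReal.ofReal (q (a ω)) ∂P) +
        (∫⁻ ω, ENNReal.ofReal (q (b ω)) ∂P + ∫⁻ ω, ENNReal.ofReal (q (b ω)) ∂P) := by
    have e : ∀ x y, ENNReal.ofReal (q x) + ENNReal.ofReal (q y) = ENNReal.ofReal (q x + q y) :=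
      fun x y => (ENNReal.ofReal_add (hq.nonneg x) (hq.nonneg y)).symm
    rw [← lintegral_add_left (by fun_prop), ← lintegral_add_left (by fun_prop),
      ← lintegral_add_left (by fun_prop), ← lintegral_add_left (by fun_prop)]
    refine lintegral_congr fun ω => ?_
    rw [e, e, e, hq.parallelogram, ENNReal.ofReal_add]
    exacts [add_nonneg (hq.nonneg _) (hq.nonneg _), add_nonneg (hq.nonneg _) (hq.nonneg _)]
  rw [h1, ← two_mul, ← two_mul, ← two_mul, ← mul_add] at h2
  exact (ENNReal.mul_right_inj (by simp) (by simp)).1 h2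

/-! ### The Riccati recursion -/

/-- One step of dynamic programming: the minimum over `u` of
`‖M z + N u‖² + q (A z + B u)` is again a sum of squares in `z`, attained at a linear feedback
`u = K z`. This is the least squares problem for `D = [N; F B]` and the target `-E z` with
`E = [M; F A]`: the minimizer is `-D† E z` and the residual `(1 - D D†) E z`. -/
theorem IsPSDForm.exists_riccati_step {σ τ : Type*} [Fintype σ] [Fintype τ] {ρ : Type} [Fintype ρ]
    (A : Matrix σ σ ℝ) (B : Matrix σ τ ℝ) (M : Matrix ρ σ ℝ) (N : Matrix ρ τ ℝ)
    {q : (σ → ℝ) → ℝ} (hq : IsPSDForm q) :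
    ∃ (q' : (σ → ℝ) → ℝ) (K : Matrix τ σ ℝ), IsPSDForm q' ∧
      (∀ z u, q' z ≤ (M *ᵥ z + N *ᵥ u) ⬝ᵥ (M *ᵥ z + N *ᵥ u) + q (A *ᵥ z + B *ᵥ u)) ∧
      ∀ z, q' z = (M *ᵥ z + N *ᵥ (K *ᵥ z)) ⬝ᵥ (M *ᵥ z + N *ᵥ (K *ᵥ z)) +
        q (A *ᵥ z + B *ᵥ (K *ᵥ z)) := by
  classical
  obtain ⟨κ, _, F, hF⟩ := hq
  set D := fromRows N (F * B)
  set E := fromRows M (F * A)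
  have hp := pinv_spec D
  set G := pinv D
  set R := (1 : Matrix (ρ ⊕ κ) (ρ ⊕ κ) ℝ) - D * G with hR
  have hRs : Rᵀ = R := by rw [hR, transpose_sub, transpose_one, hp.symm_left]
  have hRD : R * D = 0 := by rw [hR, Matrix.sub_mul, hp.mul_mul_left, Matrix.one_mul, sub_self]
  have key : ∀ z u, (M *ᵥ z + N *ᵥ u) ⬝ᵥ (M *ᵥ z + N *ᵥ u) + q (A *ᵥ z + B *ᵥ u) =
      ((R * E) *ᵥ z) ⬝ᵥ ((R * E) *ᵥ z) +
        (D *ᵥ (u - (-(G * E)) *ᵥ z)) ⬝ᵥ (D *ᵥ (u - (-(G * E)) *ᵥ z)) := by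
    intro z u
    have e1 : E *ᵥ z + D *ᵥ u = (R * E) *ᵥ z + D *ᵥ (u - (-(G * E)) *ᵥ z) := by
      simp only [hR, neg_mulVec, sub_neg_eq_add, mulVec_add, mulVec_mulVec, Matrix.sub_mul,
        Matrix.one_mul, sub_mulVec, Matrix.mul_assoc]
      abel
    have e2 : (M *ᵥ z + N *ᵥ u) ⬝ᵥ (M *ᵥ z + N *ᵥ u) + q (A *ᵥ z + B *ᵥ u) =
        (E *ᵥ z + D *ᵥ u) ⬝ᵥ (E *ᵥ z + D *ᵥ u) := by
      simp only [E, D, hF, fromRows_mulVec, dotProduct, Fintype.sum_sum_type, Pi.add_apply,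
        Sum.elim_inl, Sum.elim_inr, mulVec_add, mulVec_mulVec]
    have e3 : ∀ w y, (R *ᵥ w) ⬝ᵥ (D *ᵥ y) = 0 := by
      intro w y
      rw [← hRs, mulVec_transpose, ← dotProduct_mulVec, mulVec_mulVec, hRD, zero_mulVec,
        dotProduct_zero]
    rw [e2, e1, add_dotProduct, dotProduct_add, dotProduct_add,
      dotProduct_comm (D *ᵥ _) ((R * E) *ᵥ z), ← mulVec_mulVec, e3]
    ring
  refine ⟨fun z => ((R * E) *ᵥ z) ⬝ᵥ ((R * E) *ᵥ z), -(G * E),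
    ⟨_, inferInstance, R * E, fun _ => rfl⟩, fun z u => ?_, fun z => ?_⟩
  · rw [key]
    exact le_add_of_nonneg_right (Finset.sum_nonneg fun i _ => mul_self_nonneg _)
  · rw [key]
    simp

/-- The Riccati recursion: value functions `q k` and optimal gains `K k`, both indexed by the number
`k` of remaining steps. -/
theorem exists_riccati {σ τ : Type*} [Fintype σ] [Fintype τ] {ρ : Type} [Fintype ρ]
    (A : Matrix σ σ ℝ) (B : Matrix σ τ ℝ) (M : Matrix ρ σ ℝ) (N : Matrix ρ τ ℝ) :
    ∃ (q : ℕ → (σ → ℝ) → ℝ) (K : ℕ → Matrix τ σ ℝ), (∀ k, IsPSDForm (q k)) ∧ (∀ z, q 0 z = 0) ∧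
      (∀ k z u, q (k + 1) z ≤
        (M *ᵥ z + N *ᵥ u) ⬝ᵥ (M *ᵥ z + N *ᵥ u) + q k (A *ᵥ z + B *ᵥ u)) ∧
      ∀ k z, q (k + 1) z = (M *ᵥ z + N *ᵥ (K k *ᵥ z)) ⬝ᵥ (M *ᵥ z + N *ᵥ (K k *ᵥ z)) +
        q k (A *ᵥ z + B *ᵥ (K k *ᵥ z)) := by
  choose next gain h1 h2 h3 using fun q : {q : (σ → ℝ) → ℝ // IsPSDForm q} =>
    q.2.exists_riccati_step A B M N
  let s : ℕ → {q : (σ → ℝ) → ℝ // IsPSDForm q} :=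
    fun k => Nat.rec ⟨_, IsPSDForm.zero⟩ (fun _ q => ⟨next q, h1 q⟩) k
  exact ⟨fun k => (s k).1, fun k => gain (s k), fun k => (s k).2, fun _ => rfl,
    fun k => h2 (s k), fun k => h3 (s k)⟩

/-! ### Centred Gaussian laws -/

/-- A centred Gaussian law is invariant under `x ↦ -x`. -/
theorem ProbabilityTheory.HasGaussianLaw.map_neg_eq {Ω E : Type*} [MeasurableSpace Ω]
    {P : Measure Ω} [NormedAddCommGroup E] [NormedSpace ℝ E] [CompleteSpace E]
    [SecondCountableTopology E] [MeasurableSpace E] [BorelSpace E] {b : Ω → E}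
    (h : HasGaussianLaw b P) (h0 : ∫ ω, b ω ∂P = 0) :
    P.map (fun ω => -b ω) = P.map b := by
  have := h.isProbabilityMeasure
  have i1 := h.isGaussian_map
  have i2 := h.fun_neg.isGaussian_map
  refine Measure.ext_of_charFunDual (funext fun L => ?_)
  have e : ∫ ω, L (b ω) ∂P = 0 := by rw [L.integral_comp_comm h.integrable, h0, map_zero]
  rw [h.charFunDual_map_eq_fun, h.fun_neg.charFunDual_map_eq_fun]
  simp only [map_neg, integral_neg, e, variance_fun_neg]
  simp

instance isGaussian_gaussianVec {ι : Type*} [Fintype ι] [DecidableEq ι] (S : Matrix ι ι ℝ) :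
    IsGaussian (gaussianVec S) :=
  isGaussian_map_equiv (EuclideanSpace.equiv ι ℝ)

theorem integral_gaussianVec {ι : Type*} [Fintype ι] [DecidableEq ι] (S : Matrix ι ι ℝ) :
    ∫ x, x ∂gaussianVec S = 0 := by
  rw [gaussianVec, integral_map (by fun_prop) (by fun_prop)]
  exact ((EuclideanSpace.equiv ι ℝ).toContinuousLinearMap.integral_comp_comm
    IsGaussian.integrable_fun_id).trans (by simp)

theorem covariance_gaussianVec {ι : Type*} [Fintype ι] [DecidableEq ι] {S : Matrix ι ι ℝ}
    (hS : S.PosSemidef) (i j : ι) : cov[fun x => x i, fun x => x j; gaussianVec S] = S i j := by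
  rw [gaussianVec, covariance_map (measurable_pi_apply i).aestronglyMeasurable
    (measurable_pi_apply j).aestronglyMeasurable (by fun_prop)]
  exact covariance_eval_multivariateGaussian hS i j

theorem isGaussian_pi {ι : Type*} [Fintype ι] {E : ι → Type*} [∀ i, NormedAddCommGroup (E i)]
    [∀ i, NormedSpace ℝ (E i)] [∀ i, CompleteSpace (E i)] [∀ i, SecondCountableTopology (E i)]
    [∀ i, MeasurableSpace (E i)] [∀ i, BorelSpace (E i)] (μ : ∀ i, Measure (E i))
    [∀ i, IsGaussian (μ i)] : IsGaussian (Measure.pi μ) := by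
  have h := iIndepFun.hasGaussianLaw (P := Measure.pi μ) (X := fun i x => x i)
    (fun i => ⟨by rw [(measurePreserving_eval μ i).map_eq]; infer_instance⟩)
    (iIndepFun_pi (X := fun i x => x) fun i => aemeasurable_id)
  simpa using h.isGaussian_map

/-! ### Covariance matrices of linear images of a Gaussian measure -/

/-- The linear map `x ↦ Q x` as a continuous linear map. -/
noncomputable def Matrix.mulVecCLM {ι κ : Type*} [Fintype ι] [Fintype κ] (Q : Matrix ι κ ℝ) :
    (κ → ℝ) →L[ℝ] (ι → ℝ) :=
  LinearMap.toContinuousLinearMap Q.mulVecLin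

@[simp]
theorem Matrix.mulVecCLM_apply {ι κ : Type*} [Fintype ι] [Fintype κ] (Q : Matrix ι κ ℝ)
    (x : κ → ℝ) : Q.mulVecCLM x = Q *ᵥ x := rfl

theorem Measurable.mulVec {α ι κ : Type*} [Fintype ι] [Fintype κ] [MeasurableSpace α]
    {f : α → κ → ℝ} (hf : Measurable f) (Q : Matrix ι κ ℝ) : Measurable fun a => Q *ᵥ f a :=
  Q.mulVecCLM.continuous.measurable.comp hf

section CovMatrix

variable {E : Type*} [NormedAddCommGroup E] [NormedSpace ℝ E] [MeasurableSpace E] [BorelSpace E]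
  {μ : Measure E} {ι κ ι' : Type*}

/-- The cross-covariance matrix of the linear random vectors `f` and `g` on `(E, μ)`. -/
noncomputable def covMatrix (μ : Measure E) (f : E →L[ℝ] (ι → ℝ)) (g : E →L[ℝ] (κ → ℝ)) :
    Matrix ι κ ℝ :=
  Matrix.of fun i j => covarianceBilinDual μ
    ((ContinuousLinearMap.proj i : (ι → ℝ) →L[ℝ] ℝ).comp f)
    ((ContinuousLinearMap.proj j : (κ → ℝ) →L[ℝ] ℝ).comp g)

theorem covMatrix_apply [CompleteSpace E] [SecondCountableTopology E] [IsGaussian μ]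
    (f : E →L[ℝ] (ι → ℝ)) (g : E →L[ℝ] (κ → ℝ)) (i : ι) (j : κ) :
    covMatrix μ f g i j = cov[fun x => f x i, fun x => g x j; μ] := by
  rw [covMatrix, of_apply, covarianceBilinDual_eq_covariance (IsGaussian.memLp_two_id)]
  rfl

theorem covMatrix_transpose (f : E →L[ℝ] (ι → ℝ)) (g : E →L[ℝ] (κ → ℝ)) :
    (covMatrix μ f g)ᵀ = covMatrix μ g f := by
  ext i j
  exact covarianceBilinDual_comm _ _

theorem covMatrix_add_left (f f' : E →L[ℝ] (ι → ℝ)) (g : E →L[ℝ] (κ → ℝ)) :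
    covMatrix μ (f + f') g = covMatrix μ f g + covMatrix μ f' g := by
  ext i j
  simp [covMatrix, ContinuousLinearMap.comp_add]

theorem covMatrix_sub_left (f f' : E →L[ℝ] (ι → ℝ)) (g : E →L[ℝ] (κ → ℝ)) :
    covMatrix μ (f - f') g = covMatrix μ f g - covMatrix μ f' g := by
  ext i j
  simp [covMatrix, ContinuousLinearMap.comp_sub]

theorem covMatrix_mulVec_left [Fintype ι] [Fintype ι'] (Q : Matrix ι' ι ℝ)
    (f : E →L[ℝ] (ι → ℝ)) (g : E →L[ℝ] (κ → ℝ)) :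
    covMatrix μ (Q.mulVecCLM.comp f) g = Q * covMatrix μ f g := by
  ext i j
  have : (ContinuousLinearMap.proj i : (ι' → ℝ) →L[ℝ] ℝ).comp (Q.mulVecCLM.comp f) =
      ∑ k, Q i k • (ContinuousLinearMap.proj k : (ι → ℝ) →L[ℝ] ℝ).comp f := by
    ext x
    simp [mulVec, dotProduct]
  simp [covMatrix, this, mul_apply]

theorem covMatrix_add_right (f : E →L[ℝ] (ι → ℝ)) (g g' : E →L[ℝ] (κ → ℝ)) :
    covMatrix μ f (g + g') = covMatrix μ f g + covMatrix μ f g' := by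
  rw [← covMatrix_transpose, covMatrix_add_left, transpose_add, covMatrix_transpose,
    covMatrix_transpose]

theorem covMatrix_sub_right (f : E →L[ℝ] (ι → ℝ)) (g g' : E →L[ℝ] (κ → ℝ)) :
    covMatrix μ f (g - g') = covMatrix μ f g - covMatrix μ f g' := by
  rw [← covMatrix_transpose, covMatrix_sub_left, transpose_sub, covMatrix_transpose,
    covMatrix_transpose]

theorem covMatrix_mulVec_right [Fintype κ] [Fintype ι'] (f : E →L[ℝ] (ι → ℝ))
    (Q : Matrix ι' κ ℝ) (g : E →L[ℝ] (κ → ℝ)) :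
    covMatrix μ f (Q.mulVecCLM.comp g) = covMatrix μ f g * Qᵀ := by
  rw [← covMatrix_transpose, covMatrix_mulVec_left, transpose_mul, covMatrix_transpose]

end CovMatrix

theorem ProbabilityTheory.IndepFun.comp_measurePreserving {α β γ δ : Type*} [MeasurableSpace α]
    [MeasurableSpace β] [MeasurableSpace γ] [MeasurableSpace δ] {μ : Measure α} {ν : Measure β}
    {φ : α → β} {f : β → γ} {g : β → δ} (h : IndepFun f g ν) (hφ : MeasurePreserving φ μ ν)
    (hf : Measurable f) (hg : Measurable g) :
    IndepFun (fun x => f (φ x)) (fun x => g (φ x)) μ := by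
  rw [indepFun_iff_measure_inter_preimage_eq_mul] at h ⊢
  intro s t hs ht
  have e := h s t hs ht
  rw [← hφ.measure_preimage ((hf hs).inter (hg ht)).nullMeasurableSet,
    ← hφ.measure_preimage (hf hs).nullMeasurableSet,
    ← hφ.measure_preimage (hg ht).nullMeasurableSet] at e
  exact e

namespace LQGModel

/-! ### The primitive noise -/

variable (m : LQGModel)

/-- The space of the primitive noise: the initial state, the process noises and the observation
noises within the horizon. -/
abbrev Noise : Type :=
  (Fin m.dx → ℝ) × (Fin (m.T - 1) → Fin m.dx → ℝ) × (Fin m.T → (Σ i, Fin (m.dy i)) → ℝ)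

/-- The joint law of the process noises. -/
noncomputable def procLaw : Measure (Fin (m.T - 1) → Fin m.dx → ℝ) :=
  Measure.pi fun _ => gaussianVec m.Sw

/-- The joint law of the observation noises. -/
noncomputable def obsLaw : Measure (Fin m.T → (Σ i, Fin (m.dy i)) → ℝ) :=
  Measure.pi fun _ => gaussianVec m.Sv

/-- The law of the primitive noise. -/
noncomputable def noiseLaw : Measure m.Noise :=
  (gaussianVec m.Sx).prod (m.procLaw.prod m.obsLaw)

instance : IsGaussian m.procLaw := isGaussian_pi _

instance : IsGaussian m.obsLaw := isGaussian_pi _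

instance : IsGaussian m.noiseLaw := by
  unfold noiseLaw
  infer_instance

/-- The initial state as a linear function of the primitive noise. -/
noncomputable def initCLM : m.Noise →L[ℝ] (Fin m.dx → ℝ) := ContinuousLinearMap.fst ℝ _ _

/-- The process noise at time `t`, extended by `0` beyond the horizon. -/
noncomputable def procCLM (t : ℕ) : m.Noise →L[ℝ] (Fin m.dx → ℝ) :=
  if h : t < m.T - 1 then
    (ContinuousLinearMap.proj (⟨t, h⟩ : Fin (m.T - 1))).comp
      ((ContinuousLinearMap.fst ℝ _ _).comp (ContinuousLinearMap.snd ℝ _ _))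
  else 0

/-- The observation noise at time `t`, extended by `0` beyond the horizon. -/
noncomputable def obsCLM (t : ℕ) : m.Noise →L[ℝ] ((Σ i, Fin (m.dy i)) → ℝ) :=
  if h : t < m.T then
    (ContinuousLinearMap.proj (⟨t, h⟩ : Fin m.T)).comp
      ((ContinuousLinearMap.snd ℝ _ _).comp (ContinuousLinearMap.snd ℝ _ _))
  else 0

theorem measurePreserving_init : MeasurePreserving m.initCLM m.noiseLaw (gaussianVec m.Sx) := by
  have e := measurePreserving_fst (μ := gaussianVec m.Sx)
    (ν := m.procLaw.prod m.obsLaw)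
  exact e

theorem measurePreserving_proc {t : ℕ} (ht : t + 1 < m.T) :
    MeasurePreserving (m.procCLM t) m.noiseLaw (gaussianVec m.Sw) := by
  have h : t < m.T - 1 := by omega
  have e := ((measurePreserving_eval (fun _ : Fin (m.T - 1) => gaussianVec m.Sw) ⟨t, h⟩).comp
    (measurePreserving_fst (ν := m.obsLaw))).comp
      (measurePreserving_snd (μ := gaussianVec m.Sx))
  simp only [procCLM, h, dite_true]
  exact e

theorem measurePreserving_obs {t : ℕ} (ht : t < m.T) :
    MeasurePreserving (m.obsCLM t) m.noiseLaw (gaussianVec m.Sv) := by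
  have e := ((measurePreserving_eval (fun _ : Fin m.T => gaussianVec m.Sv) ⟨t, ht⟩).comp
    (measurePreserving_snd (μ := m.procLaw))).comp
      (measurePreserving_snd (μ := gaussianVec m.Sx))
  simp only [obsCLM, ht, dite_true]
  exact e

theorem integral_noiseLaw : ∫ x, x ∂m.noiseLaw = 0 := by
  have hi : Integrable (fun x => x) m.noiseLaw := IsGaussian.integrable_fun_id
  have key : ∀ {F : Type} [NormedAddCommGroup F] [NormedSpace ℝ F] [CompleteSpace F]
      (f : m.Noise →L[ℝ] F), f (∫ x, x ∂m.noiseLaw) = ∫ x, f x ∂m.noiseLaw :=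
    fun f => (f.integral_comp_comm hi).symm
  have mp : ∀ {ι : Type} [Fintype ι] [DecidableEq ι] {S : Matrix ι ι ℝ}
      (f : m.Noise →L[ℝ] (ι → ℝ)), MeasurePreserving f m.noiseLaw (gaussianVec S) →
      f (∫ x, x ∂m.noiseLaw) = 0 := by
    intro ι _ _ S f hf
    rw [key, ← integral_gaussianVec S, ← hf.map_eq, integral_map (by fun_prop) (by fun_prop)]
  refine Prod.ext (mp _ m.measurePreserving_init) (Prod.ext (funext fun t => ?_)
    (funext fun t => ?_))
  · have h := mp _ (m.measurePreserving_proc (t := t) (by omega))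
    simpa [procCLM] using h
  · have h := mp _ (m.measurePreserving_obs t.2)
    simpa [obsCLM] using h

theorem cov_eq_of_measurePreserving {ι : Type*} [Fintype ι] [DecidableEq ι] {S : Matrix ι ι ℝ}
    (hS : S.PosSemidef) {f : m.Noise →L[ℝ] (ι → ℝ)}
    (hf : MeasurePreserving f m.noiseLaw (gaussianVec S)) : covMatrix m.noiseLaw f f = S := by
  ext i j
  rw [covMatrix_apply, ← covariance_gaussianVec hS i j, ← hf.map_eq,
    covariance_map (measurable_pi_apply i).aestronglyMeasurable
    (measurable_pi_apply j).aestronglyMeasurable (by fun_prop)]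
  rfl

theorem cov_init_init : covMatrix m.noiseLaw m.initCLM m.initCLM = m.Sx :=
  m.cov_eq_of_measurePreserving m.Sx_psd m.measurePreserving_init

theorem cov_proc_proc {t : ℕ} (ht : t + 1 < m.T) :
    covMatrix m.noiseLaw (m.procCLM t) (m.procCLM t) = m.Sw :=
  m.cov_eq_of_measurePreserving m.Sw_psd (m.measurePreserving_proc ht)

theorem cov_obs_obs {t : ℕ} (ht : t < m.T) :
    covMatrix m.noiseLaw (m.obsCLM t) (m.obsCLM t) = m.Sv :=
  m.cov_eq_of_measurePreserving m.Sv_psd (m.measurePreserving_obs ht)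

theorem cov_eq_zero_of_indepFun {ι κ : Type*} [Fintype ι] [Fintype κ]
    {f : m.Noise →L[ℝ] (ι → ℝ)} {g : m.Noise →L[ℝ] (κ → ℝ)} (h : IndepFun f g m.noiseLaw) :
    covMatrix m.noiseLaw f g = 0 := by
  ext i j
  rw [covMatrix_apply]
  have h2 : IndepFun (fun x => f x i) (fun x => g x j) m.noiseLaw :=
    h.comp (measurable_pi_apply i) (measurable_pi_apply j)
  exact h2.covariance_eq_zero
    (IsGaussian.memLp_dual _ ((ContinuousLinearMap.proj i : (ι → ℝ) →L[ℝ] ℝ).comp f) 2 (by simp))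
    (IsGaussian.memLp_dual _ ((ContinuousLinearMap.proj j : (κ → ℝ) →L[ℝ] ℝ).comp g) 2 (by simp))

theorem cov_init_proc (t : ℕ) : covMatrix m.noiseLaw m.initCLM (m.procCLM t) = 0 := by
  apply cov_eq_zero_of_indepFun
  unfold procCLM initCLM noiseLaw
  split_ifs with h
  · exact indepFun_prod (X := id) (Y := fun y : (Fin (m.T - 1) → Fin m.dx → ℝ) ×
      (Fin m.T → (Σ i, Fin (m.dy i)) → ℝ) => y.1 ⟨t, h⟩) measurable_id (by fun_prop)
  · exact indepFun_const_right _ 0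

theorem cov_init_obs (t : ℕ) : covMatrix m.noiseLaw m.initCLM (m.obsCLM t) = 0 := by
  apply cov_eq_zero_of_indepFun
  unfold obsCLM initCLM noiseLaw
  split_ifs with h
  · exact indepFun_prod (X := id) (Y := fun y : (Fin (m.T - 1) → Fin m.dx → ℝ) ×
      (Fin m.T → (Σ i, Fin (m.dy i)) → ℝ) => y.2 ⟨t, h⟩) measurable_id (by fun_prop)
  · exact indepFun_const_right _ 0

theorem cov_proc_obs (s t : ℕ) : covMatrix m.noiseLaw (m.procCLM s) (m.obsCLM t) = 0 := by
  apply cov_eq_zero_of_indepFun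
  unfold obsCLM procCLM noiseLaw
  split_ifs with h1 h2
  · exact (indepFun_prod (μ := m.procLaw)
      (ν := m.obsLaw)
      (measurable_pi_apply (⟨s, h1⟩ : Fin (m.T - 1))) (measurable_pi_apply (⟨t, h2⟩ : Fin m.T))
      ).comp_measurePreserving measurePreserving_snd (by fun_prop) (by fun_prop)
  · exact indepFun_const_right _ 0
  · exact indepFun_const_left 0 _
  · exact indepFun_const_right _ 0

theorem cov_proc_ne {s t : ℕ} (hst : s ≠ t) :
    covMatrix m.noiseLaw (m.procCLM s) (m.procCLM t) = 0 := by
  apply cov_eq_zero_of_indepFun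
  unfold procCLM noiseLaw
  split_ifs with h1 h2
  · exact (((iIndepFun_pi (μ := fun _ : Fin (m.T - 1) => gaussianVec m.Sw) (X := fun _ x => x)
      fun _ => aemeasurable_id).indepFun (i := ⟨s, h1⟩) (j := ⟨t, h2⟩)
      (by simpa using hst)).comp_measurePreserving
        (measurePreserving_fst (ν := m.obsLaw))
        (by fun_prop) (by fun_prop)).comp_measurePreserving measurePreserving_snd
        (by fun_prop) (by fun_prop)
  · exact indepFun_const_right _ 0
  · exact indepFun_const_left 0 _
  · exact indepFun_const_right _ 0

theorem cov_obs_ne {s t : ℕ} (hst : s ≠ t) :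
    covMatrix m.noiseLaw (m.obsCLM s) (m.obsCLM t) = 0 := by
  apply cov_eq_zero_of_indepFun
  unfold obsCLM noiseLaw
  split_ifs with h1 h2
  · exact (((iIndepFun_pi (μ := fun _ : Fin m.T => gaussianVec m.Sv) (X := fun _ x => x)
      fun _ => aemeasurable_id).indepFun (i := ⟨s, h1⟩) (j := ⟨t, h2⟩)
      (by simpa using hst)).comp_measurePreserving
        (measurePreserving_snd (μ := m.procLaw))
        (by fun_prop) (by fun_prop)).comp_measurePreserving measurePreserving_snd
        (by fun_prop) (by fun_prop)
  · exact indepFun_const_right _ 0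
  · exact indepFun_const_left 0 _
  · exact indepFun_const_right _ 0

/-! ### Prediction errors and innovations -/

/-- The error of the one-step prediction of the state. It does not depend on the control strategy
and is a linear function of the primitive noise. -/
noncomputable def predErr : ℕ → m.Noise →L[ℝ] (Fin m.dx → ℝ)
  | 0 => m.initCLM
  | t + 1 => m.A.mulVecCLM.comp ((1 - m.L t * m.C).mulVecCLM.comp (predErr t) -
      (m.L t).mulVecCLM.comp (m.obsCLM t)) + m.procCLM t

/-- The error of the estimate `Z_t` of the state. -/
noncomputable def filtErr (t : ℕ) : m.Noise →L[ℝ] (Fin m.dx → ℝ) :=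
  (1 - m.L t * m.C).mulVecCLM.comp (m.predErr t) - (m.L t).mulVecCLM.comp (m.obsCLM t)

/-- The innovation at time `t`, i.e. the error of the one-step prediction of the observation. -/
noncomputable def innov (t : ℕ) : m.Noise →L[ℝ] ((Σ i, Fin (m.dy i)) → ℝ) :=
  m.C.mulVecCLM.comp (m.predErr t) + m.obsCLM t

theorem predErr_succ (t : ℕ) :
    m.predErr (t + 1) = m.A.mulVecCLM.comp (m.filtErr t) + m.procCLM t := rfl

theorem cov_predErr_proc {t r : ℕ} (h : t ≤ r) :
    covMatrix m.noiseLaw (m.predErr t) (m.procCLM r) = 0 := by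
  induction t with
  | zero => exact m.cov_init_proc r
  | succ t ih =>
    have h1 : covMatrix m.noiseLaw (m.obsCLM t) (m.procCLM r) = 0 := by
      rw [← covMatrix_transpose, cov_proc_obs, transpose_zero]
    rw [predErr_succ, filtErr, covMatrix_add_left, covMatrix_mulVec_left, covMatrix_sub_left,
      covMatrix_mulVec_left, covMatrix_mulVec_left, ih (by omega), h1, m.cov_proc_ne (by omega)]
    simp

theorem cov_predErr_obs {t r : ℕ} (h : t ≤ r) :
    covMatrix m.noiseLaw (m.predErr t) (m.obsCLM r) = 0 := by
  induction t with
  | zero => exact m.cov_init_obs r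
  | succ t ih =>
    rw [predErr_succ, filtErr, covMatrix_add_left, covMatrix_mulVec_left, covMatrix_sub_left,
      covMatrix_mulVec_left, covMatrix_mulVec_left, ih (by omega), m.cov_obs_ne (by omega),
      cov_proc_obs]
    simp

theorem cov_obs_predErr {t r : ℕ} (h : t ≤ r) :
    covMatrix m.noiseLaw (m.obsCLM r) (m.predErr t) = 0 := by
  rw [← covMatrix_transpose, m.cov_predErr_obs h, transpose_zero]

theorem cov_proc_innov {s r : ℕ} (h : s ≤ r) :
    covMatrix m.noiseLaw (m.procCLM r) (m.innov s) = 0 := by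
  rw [innov, covMatrix_add_right, covMatrix_mulVec_right, ← covMatrix_transpose (m.predErr s),
    m.cov_predErr_proc h, cov_proc_obs]
  simp

theorem cov_obs_innov {s r : ℕ} (h : s < r) :
    covMatrix m.noiseLaw (m.obsCLM r) (m.innov s) = 0 := by
  rw [innov, covMatrix_add_right, covMatrix_mulVec_right, m.cov_obs_predErr h.le,
    m.cov_obs_ne h.ne']
  simp

variable {m}

/-- The defining property of the Kalman gain. -/
theorem one_sub_gain_mul {t : ℕ} (hinv : IsUnit (m.innovCov (m.predCov t))) :
    (1 - m.L t * m.C) * m.predCov t * m.Cᵀ = m.L t * m.Sv := by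
  have h : m.L t * m.innovCov (m.predCov t) = m.predCov t * m.Cᵀ := by
    rw [L, gainOf, Matrix.mul_assoc, Matrix.nonsing_inv_mul _ ((isUnit_iff_isUnit_det _).1 hinv),
      Matrix.mul_one]
  rw [innovCov, Matrix.mul_add] at h
  rw [Matrix.sub_mul, Matrix.sub_mul, Matrix.one_mul, ← h]
  simp only [Matrix.mul_assoc]
  abel

theorem cov_predErr_self (hinv : ∀ t < m.T, IsUnit (m.innovCov (m.predCov t))) {t : ℕ}
    (ht : t < m.T) : covMatrix m.noiseLaw (m.predErr t) (m.predErr t) = m.predCov t := by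
  induction t with
  | zero => exact m.cov_init_init
  | succ t ih =>
    have hg := one_sub_gain_mul (hinv t (by omega))
    -- Joseph's form of the error covariance, simplified with the defining property of the gain
    have hf : covMatrix m.noiseLaw (m.filtErr t) (m.filtErr t) =
        (1 - m.L t * m.C) * m.predCov t := by
      simp only [filtErr, covMatrix_sub_left, covMatrix_sub_right, covMatrix_mulVec_left,
        covMatrix_mulVec_right, m.cov_predErr_obs le_rfl, m.cov_obs_predErr le_rfl,
        m.cov_obs_obs (show t < m.T by omega), ih (by omega), Matrix.mul_zero, sub_zero, zero_sub]
      rw [transpose_sub, transpose_one, transpose_mul, Matrix.mul_sub, Matrix.mul_one,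
        ← Matrix.mul_assoc _ m.Cᵀ, hg, Matrix.neg_mul, sub_neg_eq_add, sub_add_cancel]
    have hw : covMatrix m.noiseLaw (m.filtErr t) (m.procCLM t) = 0 := by
      rw [filtErr, covMatrix_sub_left, covMatrix_mulVec_left, covMatrix_mulVec_left,
        m.cov_predErr_proc le_rfl, ← covMatrix_transpose (m.procCLM t), cov_proc_obs]
      simp
    have hw' : covMatrix m.noiseLaw (m.procCLM t) (m.filtErr t) = 0 := by
      rw [← covMatrix_transpose, hw, transpose_zero]
    rw [predErr_succ]
    simp only [covMatrix_add_left, covMatrix_add_right, covMatrix_mulVec_left,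
      covMatrix_mulVec_right, hw, hw', hf, m.cov_proc_proc ht, Matrix.mul_zero, zero_add, add_zero]
    rfl

/-- If the prediction error is uncorrelated with the earlier innovations, then the error of the
updated estimate is uncorrelated with these and with the present one. -/
theorem cov_filtErr_innov_of_predErr (hinv : ∀ t < m.T, IsUnit (m.innovCov (m.predCov t)))
    {s t : ℕ} (ht : t < m.T) (hst : s < t + 1)
    (h : s < t → covMatrix m.noiseLaw (m.predErr t) (m.innov s) = 0) :
    covMatrix m.noiseLaw (m.filtErr t) (m.innov s) = 0 := by
  rw [filtErr, covMatrix_sub_left, covMatrix_mulVec_left, covMatrix_mulVec_left]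
  rcases Nat.lt_succ_iff_lt_or_eq.1 hst with hs | rfl
  · rw [h hs, m.cov_obs_innov hs]
    simp
  · simp only [innov, covMatrix_add_right, covMatrix_mulVec_right,
      m.cov_predErr_obs le_rfl, m.cov_obs_predErr le_rfl,
      m.cov_obs_obs ht, cov_predErr_self hinv ht]
    rw [add_zero, Matrix.zero_mul, zero_add, ← Matrix.mul_assoc, one_sub_gain_mul (hinv s ht),
      sub_self]

theorem cov_predErr_innov (hinv : ∀ t < m.T, IsUnit (m.innovCov (m.predCov t))) {s t : ℕ}
    (ht : t < m.T) (hst : s < t) : covMatrix m.noiseLaw (m.predErr t) (m.innov s) = 0 := by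
  induction t with
  | zero => omega
  | succ t ih =>
    rw [predErr_succ, covMatrix_add_left, covMatrix_mulVec_left,
      cov_filtErr_innov_of_predErr hinv (by omega) hst (ih (by omega)),
      m.cov_proc_innov (by omega)]
    simp

theorem cov_filtErr_innov (hinv : ∀ t < m.T, IsUnit (m.innovCov (m.predCov t))) {s t : ℕ}
    (ht : t < m.T) (hst : s < t + 1) : covMatrix m.noiseLaw (m.filtErr t) (m.innov s) = 0 :=
  cov_filtErr_innov_of_predErr hinv ht hst (cov_predErr_innov hinv ht)

theorem cov_innov_innov (hinv : ∀ t < m.T, IsUnit (m.innovCov (m.predCov t))) {s t : ℕ}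
    (ht : t < m.T) (hst : s < t) : covMatrix m.noiseLaw (m.innov t) (m.innov s) = 0 := by
  rw [innov, covMatrix_add_left, covMatrix_mulVec_left, cov_predErr_innov hinv ht hst,
    m.cov_obs_innov hst]
  simp

variable (m)

/-- The innovations before time `t`, with all their entries in one vector. -/
noncomputable def innovHist (t : ℕ) :
    m.Noise →L[ℝ] (Fin t × (Σ i, Fin (m.dy i)) → ℝ) :=
  ContinuousLinearMap.pi fun p =>
    (ContinuousLinearMap.proj p.2 : ((Σ i, Fin (m.dy i)) → ℝ) →L[ℝ] ℝ).comp (m.innov p.1)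

variable {m}

theorem innovHist_apply {t : ℕ} (x : m.Noise) (p : Fin t × (Σ i, Fin (m.dy i))) :
    m.innovHist t x p = m.innov p.1 x p.2 := rfl

/-- For jointly Gaussian vectors, uncorrelated means independent. -/
theorem indepFun_innovHist {ι : Type*} [Fintype ι] {t : ℕ} {f : m.Noise →L[ℝ] (ι → ℝ)}
    (h : ∀ s < t, covMatrix m.noiseLaw f (m.innov s) = 0) :
    IndepFun (m.innovHist t) f m.noiseLaw := by
  have hG : HasGaussianLaw (fun x => (m.innovHist t x, f x)) m.noiseLaw :=
    (IsGaussian.hasGaussianLaw_id (μ := m.noiseLaw)).map ((m.innovHist t).prod f)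
  refine HasGaussianLaw.indepFun_of_covariance_eval (X := fun p x => m.innovHist t x p)
    (Y := fun i x => f x i) hG fun p i => ?_
  rw [covariance_comm]
  simp only [innovHist_apply]
  rw [← covMatrix_apply, h _ p.1.2, Matrix.zero_apply]

theorem integral_clm {ι : Type*} [Fintype ι] (f : m.Noise →L[ℝ] (ι → ℝ)) :
    ∫ x, f x ∂m.noiseLaw = 0 := by
  rw [f.integral_comp_comm IsGaussian.integrable_fun_id, integral_noiseLaw, map_zero]

theorem map_neg_clm {ι : Type*} [Fintype ι] (f : m.Noise →L[ℝ] (ι → ℝ)) :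
    m.noiseLaw.map (fun x => -f x) = m.noiseLaw.map f :=
  HasGaussianLaw.map_neg_eq ((IsGaussian.hasGaussianLaw_id (μ := m.noiseLaw)).map f)
    (integral_clm f)

/-! ### Block vectors -/

theorem measurable_vec {α : Type*} [MeasurableSpace α] {n : ℕ} {d : Fin n → ℕ}
    {f : ∀ i, α → Fin (d i) → ℝ} (hf : ∀ i, Measurable (f i)) :
    Measurable fun a => vec fun i => f i a :=
  measurable_pi_lambda _ fun p => (measurable_pi_apply p.2).comp (hf p.1)

theorem measurable_blk {α : Type*} [MeasurableSpace α] {n : ℕ} {d : Fin n → ℕ}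
    {f : α → (Σ i, Fin (d i)) → ℝ} (hf : Measurable f) (i : Fin n) :
    Measurable fun a => blk (f a) i :=
  measurable_pi_lambda _ fun k => (measurable_pi_apply (⟨i, k⟩ : Σ i, Fin (d i))).comp hf

theorem mulVec_vec {n r : ℕ} {d : Fin n → ℕ} (Q : Matrix (Fin r) (Σ i, Fin (d i)) ℝ)
    (v : ∀ i, Fin (d i) → ℝ) : Q *ᵥ vec v = ∑ i, colBlk Q i *ᵥ v i := by
  ext k
  simp [mulVec, dotProduct, vec, colBlk, Fintype.sum_sigma]

theorem mulVec_vec_single {n r : ℕ} {d : Fin n → ℕ} (Q : Matrix (Fin r) (Σ i, Fin (d i)) ℝ)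
    (i : Fin n) (v : Fin (d i) → ℝ) : Q *ᵥ vec (Pi.single i v) = colBlk Q i *ᵥ v := by
  rw [mulVec_vec, Finset.sum_eq_single i]
  · rw [Pi.single_eq_same]
  · intro j _ hj
    rw [Pi.single_eq_of_ne hj, mulVec_zero]
  · simp

/-- Under substitutability, `u` and `Λ^i u`, applied by controller `i` alone, have the same effect
on the state and on the cost. -/
theorem Substitutable.colBlk_mulVec_Lam (h : m.Substitutable) (i : Fin m.n)
    (u : (Σ j, Fin (m.du j)) → ℝ) :
    colBlk m.B i *ᵥ (m.Lam i *ᵥ u) = m.B *ᵥ u ∧ colBlk m.N i *ᵥ (m.Lam i *ᵥ u) = m.N *ᵥ u := by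
  obtain ⟨v, hB, hN⟩ := h i u
  rw [mulVec_vec_single] at hB hN
  have hv : fromRows m.B m.N *ᵥ u = fromRows (colBlk m.B i) (colBlk m.N i) *ᵥ v := by
    rw [fromRows_mulVec, fromRows_mulVec, hB, hN]
  have e : fromRows (colBlk m.B i) (colBlk m.N i) *ᵥ (m.Lam i *ᵥ u) = fromRows m.B m.N *ᵥ u := by
    rw [Lam, ← mulVec_mulVec, hv, mulVec_mulVec, mulVec_mulVec, (pinv_spec _).mul_mul_left]
  rw [fromRows_mulVec, fromRows_mulVec] at e
  exact ⟨funext fun k => congrFun e (Sum.inl k), funext fun k => congrFun e (Sum.inr k)⟩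

/-! ### The statistics as functions of the record -/

theorem fullHistory_mono {s t : ℕ} (h : s ≤ t) : m.fullHistory s ⊆ m.fullHistory t := by
  rintro ℓ (⟨j, r, hr, rfl⟩ | ⟨j, r, hr, rfl⟩)
  · exact Or.inl ⟨j, r, hr.trans h, rfl⟩
  · exact Or.inr ⟨j, r, hr.trans_le h, rfl⟩

theorem obs_mem_fullHistory (i : Fin m.n) {s t : ℕ} (h : s ≤ t) :
    Var.obs i s ∈ m.fullHistory t := Or.inl ⟨i, s, h, rfl⟩

theorem act_mem_fullHistory (i : Fin m.n) {s t : ℕ} (h : s < t) :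
    Var.act i s ∈ m.fullHistory t := Or.inr ⟨i, s, h, rfl⟩

theorem ownInfo_mono (i : Fin m.n) {s t : ℕ} (h : s ≤ t) : m.ownInfo i s ⊆ m.ownInfo i t := by
  rintro ℓ (⟨r, hr, rfl⟩ | ⟨r, hr, rfl⟩)
  · exact Or.inl ⟨r, hr.trans h, rfl⟩
  · exact Or.inr ⟨r, hr.trans_le h, rfl⟩

theorem Z_dependsOn (t : ℕ) : DependsOn (fun ρ => m.Z ρ t) (m.fullHistory t) := by
  induction t with
  | zero =>
    intro ρ ρ' h
    simp only [Z]
    simp_rw [h _ (obs_mem_fullHistory _ le_rfl)]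
  | succ t ih =>
    intro ρ ρ' h
    have := ih fun ℓ hℓ => h ℓ (fullHistory_mono t.le_succ hℓ)
    simp only [Z]
    simp only at this
    simp_rw [this, h _ (obs_mem_fullHistory _ le_rfl), h _ (act_mem_fullHistory _ t.lt_succ_self)]

theorem S_dependsOn (i : Fin m.n) (t : ℕ) : DependsOn (fun ρ => m.S ρ i t) (m.ownInfo i t) := by
  induction t with
  | zero =>
    intro ρ ρ' h
    simp only [S]
    rw [h (.obs i 0) (Or.inl ⟨0, le_rfl, rfl⟩)]
  | succ t ih =>
    intro ρ ρ' h
    have := ih fun ℓ hℓ => h ℓ (ownInfo_mono i t.le_succ hℓ)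
    simp only [S]
    simp only at this
    rw [this, h (.obs i (t + 1)) (Or.inl ⟨_, le_rfl, rfl⟩),
      h (.act i t) (Or.inr ⟨_, t.lt_succ_self, rfl⟩)]

/-- The estimate is a measurable function of any record process whose relevant entries are
measurable. -/
theorem measurable_Z_of_forall {α : Type*} [MeasurableSpace α] {r : α → m.Record} (t : ℕ)
    (h : ∀ ℓ ∈ m.fullHistory t, Measurable fun a => r a ℓ) : Measurable fun a => m.Z (r a) t := by
  induction t with
  | zero => exact (measurable_vec fun i => h (.obs i 0) (obs_mem_fullHistory _ le_rfl)).mulVec _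
  | succ t ih =>
    exact ((((ih fun ℓ hℓ => h ℓ (fullHistory_mono t.le_succ hℓ)).mulVec _).add
      ((measurable_vec fun i => h (.act i t) (act_mem_fullHistory _ t.lt_succ_self)).mulVec
        _)).mulVec _).add
      ((measurable_vec fun i => h (.obs i (t + 1)) (obs_mem_fullHistory _ le_rfl)).mulVec _)

theorem measurable_Z (t : ℕ) : Measurable fun ρ => m.Z ρ t :=
  measurable_Z_of_forall (r := id) t fun ℓ _ => measurable_pi_apply ℓ

theorem measurable_S (i : Fin m.n) (t : ℕ) : Measurable fun ρ => m.S ρ i t := by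
  induction t with
  | zero => exact (measurable_pi_apply (Var.obs i 0)).mulVec (colBlk (m.L 0) i)
  | succ t ih =>
    exact (((ih.mulVec _).add ((measurable_pi_apply (Var.act i t)).mulVec
      (colBlk m.B i))).mulVec _).add
      ((measurable_pi_apply (Var.obs i (t + 1))).mulVec (colBlk (m.L (t + 1)) i))

/-- The local statistics add up to the centralized estimate, on every record. -/
theorem sum_S (ρ : m.Record) (t : ℕ) : ∑ i, m.S ρ i t = m.Z ρ t := by
  induction t with
  | zero => simp only [S, Z, mulVec_vec]
  | succ t ih =>
    simp only [S, Z, mulVec_vec, Finset.sum_add_distrib, ← mulVec_sum, ih]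

theorem admissible_centralStrategy (K : m.Gains) :
    m.Admissible m.centralInfo (m.centralStrategy K) := by
  intro i t _
  refine ⟨?_, fun ρ ρ' h => ?_⟩
  · exact measurable_blk ((measurable_Z t).mulVec (K t)) i
  · have := Z_dependsOn t h
    simp only at this
    simp only [centralStrategy, this]

theorem admissible_localStrategy {I : m.InfoStructure}
    (hI : ∀ i, ∀ t < m.T, m.ownInfo i t ⊆ I i t) (K : m.Gains) :
    m.Admissible I (m.localStrategy K) := by
  intro i t ht
  refine ⟨?_, fun ρ ρ' h => ?_⟩
  · exact ((measurable_S i t).mulVec (K t)).mulVec (m.Lam i)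
  · have := S_dependsOn i t fun ℓ hℓ => h ℓ (hI i t ht hℓ)
    simp only at this
    simp only [localStrategy, this]

/-! ### The closed loop -/

section Processes

variable {Ω : Type*} {X₁ : Ω → Fin m.dx → ℝ} {W : ℕ → Ω → Fin m.dx → ℝ}
  {V : ℕ → Ω → (Σ i, Fin (m.dy i)) → ℝ} {g : m.Strategy}

theorem X_succ (t : ℕ) (ω : Ω) : m.X X₁ W V g (t + 1) ω =
    m.A *ᵥ m.X X₁ W V g t ω + m.B *ᵥ m.U X₁ W V g t ω + W t ω := rfl

theorem record_obs (t : ℕ) (ω : Ω) (i : Fin m.n) : m.record X₁ W V g t ω (.obs i t) =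
    blk (m.C *ᵥ m.X X₁ W V g t ω + V t ω) i := by
  cases t <;> simp [record, X, run]

theorem record_succ_act (t : ℕ) (ω : Ω) (i : Fin m.n) :
    m.record X₁ W V g (t + 1) ω (.act i t) = blk (m.U X₁ W V g t ω) i := by
  simp [record, U, run]
  rfl

theorem record_succ_of_mem {t : ℕ} {ℓ : Var m.n} (h : ℓ ∈ m.fullHistory t) (ω : Ω) :
    m.record X₁ W V g (t + 1) ω ℓ = m.record X₁ W V g t ω ℓ := by
  rcases h with ⟨j, s, hs, rfl⟩ | ⟨j, s, hs, rfl⟩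
  · simp [record, run, show s ≠ t + 1 by omega]
  · simp [record, run, show s ≠ t by omega]

/-- The entries of the record for variables not yet realized vanish. -/
theorem record_of_notMem {t : ℕ} {ℓ : Var m.n} (h : ℓ ∉ m.fullHistory t) (ω : Ω) :
    m.record X₁ W V g t ω ℓ = 0 := by
  induction t with
  | zero =>
    cases ℓ with
    | obs i s =>
      have : s ≠ 0 := by rintro rfl; exact h (obs_mem_fullHistory _ le_rfl)
      simp [record, run, this]
    | act i s => rfl
  | succ t ih =>
    have ih' := ih fun hm => h (fullHistory_mono t.le_succ hm)
    cases ℓ with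
    | obs i s =>
      have : s ≠ t + 1 := by rintro rfl; exact h (obs_mem_fullHistory _ le_rfl)
      simpa [record, run, this] using ih'
    | act i s =>
      have : s ≠ t := by rintro rfl; exact h (act_mem_fullHistory _ (Nat.lt_succ_self _))
      simpa [record, run, this] using ih'

variable (X₁ W V g)

/-- The estimate `Z_t` in closed loop. -/
noncomputable def Zc (t : ℕ) (ω : Ω) : Fin m.dx → ℝ := m.Z (m.record X₁ W V g t ω) t

/-- The one-step prediction `A Z_{t-1} + B U_{t-1}` of the state in closed loop. -/
noncomputable def Zpred : ℕ → Ω → Fin m.dx → ℝ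
  | 0, _ => 0
  | t + 1, ω => m.A *ᵥ Zc X₁ W V g t ω + m.B *ᵥ m.U X₁ W V g t ω

/-- The primitive noise as a random vector. -/
def primNoise (ω : Ω) : m.Noise :=
  (X₁ ω, (fun t : Fin (m.T - 1) => W t ω), fun t : Fin m.T => V t ω)

variable {X₁ W V g}

theorem Zc_eq (t : ℕ) (ω : Ω) : Zc X₁ W V g t ω =
    (1 - m.L t * m.C) *ᵥ Zpred X₁ W V g t ω + m.L t *ᵥ (m.C *ᵥ m.X X₁ W V g t ω + V t ω) := by
  cases t with
  | zero =>
    simp only [Zc, Z, Zpred, record_obs, mulVec_zero, zero_add]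
    rfl
  | succ t =>
    have := Z_dependsOn (m := m) t fun ℓ hℓ =>
      record_succ_of_mem (X₁ := X₁) (W := W) (V := V) (g := g) hℓ ω
    simp only at this
    simp only [Zc, Z, Zpred, record_obs, record_succ_act, this]
    rfl

theorem X_eq_Zpred_add {t : ℕ} (ht : t < m.T) (ω : Ω) : m.X X₁ W V g t ω =
    Zpred X₁ W V g t ω + m.predErr t (primNoise X₁ W V ω) := by
  induction t with
  | zero => simp [Zpred, predErr, initCLM, primNoise, X, run]
  | succ t ih =>
    have hw : m.procCLM t (primNoise X₁ W V ω) = W t ω := by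
      simp [procCLM, show t < m.T - 1 by omega, primNoise]
    have hv : m.obsCLM t (primNoise X₁ W V ω) = V t ω := by
      simp [obsCLM, show t < m.T by omega, primNoise]
    rw [X_succ, Zpred, predErr, Zc_eq, ih (by omega)]
    simp only [_root_.add_apply, _root_.sub_apply,
      ContinuousLinearMap.comp_apply, mulVecCLM_apply, hw, hv, mulVec_add, mulVec_sub, sub_mulVec,
      one_mulVec, mulVec_mulVec]
    abel

theorem obs_eq {t : ℕ} (ht : t < m.T) (ω : Ω) : m.C *ᵥ m.X X₁ W V g t ω + V t ω =
    m.C *ᵥ Zpred X₁ W V g t ω + m.innov t (primNoise X₁ W V ω) := by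
  have hv : m.obsCLM t (primNoise X₁ W V ω) = V t ω := by
    simp [obsCLM, ht, primNoise]
  rw [X_eq_Zpred_add ht, innov, _root_.add_apply, hv, mulVec_add, add_assoc]
  rfl

theorem Zc_eq_Zpred_add {t : ℕ} (ht : t < m.T) (ω : Ω) : Zc X₁ W V g t ω =
    Zpred X₁ W V g t ω + m.L t *ᵥ m.innov t (primNoise X₁ W V ω) := by
  rw [Zc_eq, obs_eq ht, sub_mulVec, one_mulVec, mulVec_add, mulVec_mulVec]
  abel

theorem X_eq_Zc_add {t : ℕ} (ht : t < m.T) (ω : Ω) : m.X X₁ W V g t ω =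
    Zc X₁ W V g t ω + m.filtErr t (primNoise X₁ W V ω) := by
  rw [Zc_eq_Zpred_add ht, X_eq_Zpred_add ht, innov, filtErr]
  simp only [_root_.add_apply, _root_.sub_apply,
    ContinuousLinearMap.comp_apply, mulVecCLM_apply, mulVec_add, sub_mulVec, one_mulVec,
    mulVec_mulVec]
  abel

/-! ### Coordination without communication -/

/-- Under the decentralized strategies the state, the observations and the effect of the actions
coincide, in every realization, with those under the centralized strategy. -/
theorem localStrategy_eq (hsub : m.Substitutable) (K : m.Gains) (t : ℕ) (ω : Ω) :
    m.X X₁ W V (m.localStrategy K) t ω = m.X X₁ W V (m.centralStrategy K) t ω ∧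
    m.N *ᵥ m.U X₁ W V (m.localStrategy K) t ω = m.N *ᵥ m.U X₁ W V (m.centralStrategy K) t ω := by
  have hU : ∀ t, m.B *ᵥ m.U X₁ W V (m.localStrategy K) t ω =
        m.B *ᵥ (K t *ᵥ Zc X₁ W V (m.localStrategy K) t ω) ∧
      m.N *ᵥ m.U X₁ W V (m.localStrategy K) t ω =
        m.N *ᵥ (K t *ᵥ Zc X₁ W V (m.localStrategy K) t ω) := by
    intro t
    simp only [U, localStrategy, mulVec_vec, (hsub.colBlk_mulVec_Lam _ _).1,
      (hsub.colBlk_mulVec_Lam _ _).2, ← mulVec_sum, sum_S, Zc, and_self]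
  have hUc : ∀ t, m.U X₁ W V (m.centralStrategy K) t ω =
      K t *ᵥ Zc X₁ W V (m.centralStrategy K) t ω := fun _ => rfl
  have key : ∀ t, m.X X₁ W V (m.localStrategy K) t ω = m.X X₁ W V (m.centralStrategy K) t ω ∧
      Zpred X₁ W V (m.localStrategy K) t ω = Zpred X₁ W V (m.centralStrategy K) t ω := by
    intro t
    induction t with
    | zero => exact ⟨rfl, rfl⟩
    | succ t ih =>
      have hZ : Zc X₁ W V (m.localStrategy K) t ω = Zc X₁ W V (m.centralStrategy K) t ω := by
        rw [Zc_eq, Zc_eq, ih.1, ih.2]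
      simp only [X_succ, Zpred, (hU t).1, hUc, hZ, ih.1, and_self]
  refine ⟨(key t).1, ?_⟩
  rw [(hU t).2, hUc, Zc_eq, Zc_eq, (key t).1, (key t).2]

end Processes

/-! ### Adaptedness to the innovations -/

section Adapted

variable {Ω : Type*} [MeasurableSpace Ω] {X₁ : Ω → Fin m.dx → ℝ} {W : ℕ → Ω → Fin m.dx → ℝ}
  {V : ℕ → Ω → (Σ i, Fin (m.dy i)) → ℝ} {g : m.Strategy}

theorem measurable_U (hg : ∀ i, ∀ t < m.T, Measurable (g i t)) {t : ℕ} (ht : t < m.T)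
    (h : Measurable (m.record X₁ W V g t)) : Measurable (m.U X₁ W V g t) :=
  measurable_vec fun i => (hg i t ht).comp h

theorem measurable_Zpred_succ (hg : ∀ i, ∀ t < m.T, Measurable (g i t)) {t : ℕ} (ht : t < m.T)
    (h : Measurable (m.record X₁ W V g t)) : Measurable (Zpred X₁ W V g (t + 1)) :=
  (((measurable_Z t).comp h).mulVec m.A).add ((measurable_U hg ht h).mulVec m.B)

/-- The record is a measurable function of the innovations up to the same time, whatever the
strategy. This is stated for any sigma-algebra on `Ω` that makes the innovations measurable. -/
theorem measurable_record (hg : ∀ i, ∀ t < m.T, Measurable (g i t)) {t : ℕ} (ht : t < m.T)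
    (h : ∀ s ≤ t, Measurable fun ω => m.innov s (primNoise X₁ W V ω)) :
    Measurable (m.record X₁ W V g t) := by
  have hobs : ∀ s ≤ t, Measurable (Zpred X₁ W V g s) → ∀ i,
      Measurable fun ω => m.record X₁ W V g s ω (.obs i s) := by
    intro s hs hZ i
    simp only [record_obs, obs_eq (show s < m.T by omega)]
    exact measurable_blk ((hZ.mulVec _).add (h s hs)) i
  induction t with
  | zero =>
    refine measurable_pi_iff.2 fun ℓ => ?_
    by_cases hℓ : ℓ ∈ m.fullHistory 0
    · rcases hℓ with ⟨j, s, hs, rfl⟩ | ⟨j, s, hs, rfl⟩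
      · obtain rfl : s = 0 := by omega
        exact hobs 0 le_rfl measurable_const j
      · omega
    · simp only [record_of_notMem hℓ]
      exact measurable_const
  | succ t ih =>
    have ih' := ih (by omega) (fun s hs => h s (by omega)) fun s hs => hobs s (by omega)
    refine measurable_pi_iff.2 fun ℓ => ?_
    by_cases hℓ : ℓ ∈ m.fullHistory t
    · simp only [record_succ_of_mem hℓ]
      exact measurable_pi_iff.1 ih' ℓ
    by_cases hℓ' : ℓ ∈ m.fullHistory (t + 1)
    · rcases hℓ' with ⟨j, s, hs, rfl⟩ | ⟨j, s, hs, rfl⟩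
      · obtain rfl : s = t + 1 := by
          by_contra hne
          exact hℓ (obs_mem_fullHistory j (by omega))
        exact hobs _ le_rfl (measurable_Zpred_succ hg (by omega) ih') j
      · obtain rfl : s = t := by
          by_contra hne
          exact hℓ (act_mem_fullHistory j (by omega))
        simp only [record_succ_act]
        exact measurable_blk (measurable_U hg (by omega) ih') j
    · simp only [record_of_notMem hℓ']
      exact measurable_const

theorem measurable_Zpred (hg : ∀ i, ∀ t < m.T, Measurable (g i t)) {t : ℕ} (ht : t ≤ m.T)
    (h : ∀ s < t, Measurable fun ω => m.innov s (primNoise X₁ W V ω)) :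
    Measurable (Zpred X₁ W V g t) := by
  cases t with
  | zero => exact measurable_const
  | succ t =>
    exact measurable_Zpred_succ hg ht (measurable_record hg ht fun s hs => h s (by omega))

omit [MeasurableSpace Ω] in
theorem measurable_innov_of_innovHist {s t : ℕ} (h : s < t) :
    Measurable[MeasurableSpace.comap (fun ω => m.innovHist t (primNoise X₁ W V ω)) inferInstance]
      fun ω => m.innov s (primNoise X₁ W V ω) := by
  have h1 : Measurable fun y : Fin t × (Σ i, Fin (m.dy i)) → ℝ => fun p => y (⟨s, h⟩, p) := by
    fun_prop
  exact h1.comp (comap_measurable _)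

end Adapted

/-! ### Independence of the errors from the past -/

section Probability

variable {Ω : Type*} [MeasurableSpace Ω] {P : Measure Ω}
  {X₁ : Ω → Fin m.dx → ℝ} {W : ℕ → Ω → Fin m.dx → ℝ}
  {V : ℕ → Ω → (Σ i, Fin (m.dy i)) → ℝ} {g : m.Strategy}

theorem IsNoise.measurePreserving (h : m.IsNoise X₁ W V P) :
    MeasurePreserving (primNoise X₁ W V) P m.noiseLaw where
  measurable := h.measurable_init.prodMk
    ((measurable_pi_lambda _ fun t : Fin (m.T - 1) => h.measurable_process t (by omega)).prodMk
      (measurable_pi_lambda _ fun t : Fin m.T => h.measurable_observation t t.2))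
  map_eq := h.law

variable (hnoise : m.IsNoise X₁ W V P)
include hnoise

theorem measurable_clm {ι : Type*} [Fintype ι] (f : m.Noise →L[ℝ] (ι → ℝ)) :
    Measurable fun ω => f (primNoise X₁ W V ω) :=
  f.continuous.measurable.comp hnoise.measurePreserving.measurable

theorem map_neg_primNoise {ι : Type*} [Fintype ι] (f : m.Noise →L[ℝ] (ι → ℝ)) :
    P.map (fun ω => -f (primNoise X₁ W V ω)) = P.map fun ω => f (primNoise X₁ W V ω) := by
  have h := map_neg_clm f
  have hm := hnoise.measurePreserving.measurable
  rw [← hnoise.measurePreserving.map_eq, Measure.map_map (by fun_prop) hm,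
    Measure.map_map (by fun_prop) hm] at h
  exact h

theorem integrable_clm {ι : Type*} [Fintype ι] (f : m.Noise →L[ℝ] (ι → ℝ)) :
    Integrable (fun ω => f (primNoise X₁ W V ω)) P :=
  hnoise.measurePreserving.integrable_comp_of_integrable
    (f.integrable_comp IsGaussian.integrable_fun_id)

theorem integral_clm_primNoise {ι : Type*} [Fintype ι] (f : m.Noise →L[ℝ] (ι → ℝ)) :
    ∫ ω, f (primNoise X₁ W V ω) ∂P = 0 := by
  rw [← integral_clm f, ← hnoise.measurePreserving.map_eq,
    integral_map hnoise.measurePreserving.measurable.aemeasurable (by fun_prop)]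

/-- A linear function of the noise which is uncorrelated with the innovations before time `t` is
independent of everything that is measurable with respect to these innovations. -/
theorem indepFun_of_innov {α ι : Type*} [MeasurableSpace α] [Fintype ι] {t : ℕ} {a : Ω → α}
    (ha : Measurable[MeasurableSpace.comap (fun ω => m.innovHist t (primNoise X₁ W V ω))
      inferInstance] a)
    {f : m.Noise →L[ℝ] (ι → ℝ)} (h : ∀ s < t, covMatrix m.noiseLaw f (m.innov s) = 0) :
    IndepFun a (fun ω => f (primNoise X₁ W V ω)) P := by
  have h1 := (indepFun_innovHist h).comp_measurePreserving hnoise.measurePreserving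
    (by fun_prop) (by fun_prop)
  rw [IndepFun_iff_Indep] at h1 ⊢
  exact indep_of_indep_of_le_left h1 ha.comap_le

variable (hg : ∀ i, ∀ t < m.T, Measurable (g i t))
include hg

theorem measurable_record_of_isNoise {t : ℕ} (ht : t < m.T) :
    Measurable (m.record X₁ W V g t) :=
  measurable_record hg ht fun s _ => measurable_clm hnoise (m.innov s)

theorem measurable_Zc {t : ℕ} (ht : t < m.T) : Measurable (Zc X₁ W V g t) :=
  (measurable_Z t).comp (measurable_record_of_isNoise hnoise hg ht)

theorem measurable_X {t : ℕ} (ht : t < m.T) : Measurable (m.X X₁ W V g t) := by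
  rw [show m.X X₁ W V g t = _ from funext fun ω => X_eq_Zc_add ht ω]
  exact (measurable_Zc hnoise hg ht).add (measurable_clm hnoise _)

theorem measurable_stage {t : ℕ} (ht : t < m.T) :
    Measurable fun ω => m.M *ᵥ m.X X₁ W V g t ω + m.N *ᵥ m.U X₁ W V g t ω :=
  ((measurable_X hnoise hg ht).mulVec m.M).add
    ((measurable_U hg ht (measurable_record_of_isNoise hnoise hg ht)).mulVec m.N)

/-- The expected cost as the sum of the expected stage costs, backwards in time. -/
theorem cost_eq_sum : m.cost X₁ W V g P = ∑ j ∈ Finset.range m.T, ∫⁻ ω, ENNReal.ofReal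
    ((m.M *ᵥ m.X X₁ W V g (m.T - 1 - j) ω + m.N *ᵥ m.U X₁ W V g (m.T - 1 - j) ω) ⬝ᵥ
      (m.M *ᵥ m.X X₁ W V g (m.T - 1 - j) ω + m.N *ᵥ m.U X₁ W V g (m.T - 1 - j) ω)) ∂P := by
  have h : m.cost X₁ W V g P = ∑ t ∈ Finset.range m.T, ∫⁻ ω, ENNReal.ofReal
      ((m.M *ᵥ m.X X₁ W V g t ω + m.N *ᵥ m.U X₁ W V g t ω) ⬝ᵥ
        (m.M *ᵥ m.X X₁ W V g t ω + m.N *ᵥ m.U X₁ W V g t ω)) ∂P := by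
    rw [cost, ← lintegral_finsetSum]
    · refine lintegral_congr fun ω => ENNReal.ofReal_sum_of_nonneg fun t _ => ?_
      exact IsPSDForm.dotProduct_self.nonneg _
    · intro t ht
      exact (IsPSDForm.dotProduct_self.measurable.comp
        (measurable_stage hnoise hg (Finset.mem_range.1 ht))).ennreal_ofReal
  rw [h]
  exact (Finset.sum_range_reflect _ m.T).symm

variable (hinv : ∀ t < m.T, IsUnit (m.innovCov (m.predCov t)))
include hinv

theorem indepFun_record_filtErr {t : ℕ} (ht : t < m.T) :
    IndepFun (m.record X₁ W V g t) (fun ω => m.filtErr t (primNoise X₁ W V ω)) P :=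
  indepFun_of_innov hnoise (t := t + 1)
    (@measurable_record m Ω (MeasurableSpace.comap _ _) X₁ W V g hg t ht fun _ hs =>
      measurable_innov_of_innovHist (Nat.lt_succ_of_le hs))
    fun _ hs => cov_filtErr_innov hinv ht hs

theorem indepFun_Zpred_innov {t : ℕ} (ht : t < m.T) :
    IndepFun (Zpred X₁ W V g t) (fun ω => m.innov t (primNoise X₁ W V ω)) P :=
  indepFun_of_innov hnoise (t := t)
    (@measurable_Zpred m Ω (MeasurableSpace.comap _ _) X₁ W V g hg t ht.le fun _ hs =>
      measurable_innov_of_innovHist hs)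
    fun _ hs => cov_innov_innov hinv ht hs

/-! ### Dynamic programming -/

variable [IsProbabilityMeasure P]

theorem lintegral_Zc {q : (Fin m.dx → ℝ) → ℝ} (hq : IsPSDForm q) {t : ℕ} (ht : t < m.T) :
    ∫⁻ ω, ENNReal.ofReal (q (Zc X₁ W V g t ω)) ∂P =
      ∫⁻ ω, ENNReal.ofReal (q (Zpred X₁ W V g t ω)) ∂P +
        ∫⁻ ω, ENNReal.ofReal (q (m.L t *ᵥ m.innov t (primNoise X₁ W V ω))) ∂P := by
  rw [← hq.lintegral_add]
  · exact lintegral_congr fun ω => by rw [Zc_eq_Zpred_add ht]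
  · exact measurable_Zpred hg ht.le fun s _ => measurable_clm hnoise _
  · exact (measurable_clm hnoise (m.innov t)).mulVec _
  · exact (indepFun_Zpred_innov hnoise hg hinv ht).comp (φ := id) measurable_id
      (measurable_id.mulVec (m.L t))
  · exact map_neg_primNoise hnoise ((m.L t).mulVecCLM.comp (m.innov t))

/-- The expected stage cost is that of the estimated state plus a term that does not depend on the
strategy. -/
theorem lintegral_stage {t : ℕ} (ht : t < m.T) :
    ∫⁻ ω, ENNReal.ofReal ((m.M *ᵥ m.X X₁ W V g t ω + m.N *ᵥ m.U X₁ W V g t ω) ⬝ᵥ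
        (m.M *ᵥ m.X X₁ W V g t ω + m.N *ᵥ m.U X₁ W V g t ω)) ∂P =
      ∫⁻ ω, ENNReal.ofReal ((m.M *ᵥ Zc X₁ W V g t ω + m.N *ᵥ m.U X₁ W V g t ω) ⬝ᵥ
        (m.M *ᵥ Zc X₁ W V g t ω + m.N *ᵥ m.U X₁ W V g t ω)) ∂P +
      ∫⁻ ω, ENNReal.ofReal ((m.M *ᵥ m.filtErr t (primNoise X₁ W V ω)) ⬝ᵥ
        (m.M *ᵥ m.filtErr t (primNoise X₁ W V ω))) ∂P := by
  have hφ : Measurable fun ρ : m.Record => m.M *ᵥ m.Z ρ t + m.N *ᵥ vec (fun i => g i t ρ) :=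
    ((measurable_Z t).mulVec m.M).add ((measurable_vec fun i => hg i t ht).mulVec m.N)
  have hr := measurable_record_of_isNoise hnoise hg ht
  rw [← IsPSDForm.dotProduct_self.lintegral_add
    (a := fun ω => m.M *ᵥ Zc X₁ W V g t ω + m.N *ᵥ m.U X₁ W V g t ω)
    (b := fun ω => m.M *ᵥ m.filtErr t (primNoise X₁ W V ω))]
  · refine lintegral_congr fun ω => ?_
    rw [X_eq_Zc_add ht, mulVec_add, add_right_comm]
  · exact hφ.comp hr
  · exact (measurable_clm hnoise (m.filtErr t)).mulVec _
  · exact (indepFun_record_filtErr hnoise hg hinv ht).comp hφ (measurable_id.mulVec m.M)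
  · exact map_neg_primNoise hnoise (m.M.mulVecCLM.comp (m.filtErr t))

/-- The terms of the cost that no strategy can influence: the estimation error and the cost of the
innovation, for the value function `q` at the respective time. -/
noncomputable def fixedCost (P : Measure Ω) (X₁ : Ω → Fin m.dx → ℝ) (W : ℕ → Ω → Fin m.dx → ℝ)
    (V : ℕ → Ω → (Σ i, Fin (m.dy i)) → ℝ) (q : (Fin m.dx → ℝ) → ℝ) (t : ℕ) : ENNReal :=
  ∫⁻ ω, ENNReal.ofReal (q (m.L t *ᵥ m.innov t (primNoise X₁ W V ω))) ∂P +
    ∫⁻ ω, ENNReal.ofReal ((m.M *ᵥ m.filtErr t (primNoise X₁ W V ω)) ⬝ᵥ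
      (m.M *ᵥ m.filtErr t (primNoise X₁ W V ω))) ∂P

/-- The expected stage cost plus the expected value at the next prediction. -/
theorem lintegral_stage_add {q : (Fin m.dx → ℝ) → ℝ} (hq : IsPSDForm q) {t : ℕ} (ht : t < m.T) :
    ∫⁻ ω, ENNReal.ofReal ((m.M *ᵥ m.X X₁ W V g t ω + m.N *ᵥ m.U X₁ W V g t ω) ⬝ᵥ
        (m.M *ᵥ m.X X₁ W V g t ω + m.N *ᵥ m.U X₁ W V g t ω)) ∂P +
      ∫⁻ ω, ENNReal.ofReal (q (Zpred X₁ W V g (t + 1) ω)) ∂P =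
    ∫⁻ ω, ENNReal.ofReal ((m.M *ᵥ Zc X₁ W V g t ω + m.N *ᵥ m.U X₁ W V g t ω) ⬝ᵥ
        (m.M *ᵥ Zc X₁ W V g t ω + m.N *ᵥ m.U X₁ W V g t ω) +
          q (m.A *ᵥ Zc X₁ W V g t ω + m.B *ᵥ m.U X₁ W V g t ω)) ∂P +
      ∫⁻ ω, ENNReal.ofReal ((m.M *ᵥ m.filtErr t (primNoise X₁ W V ω)) ⬝ᵥ
        (m.M *ᵥ m.filtErr t (primNoise X₁ W V ω))) ∂P := by
  rw [lintegral_stage hnoise hg hinv ht, add_right_comm, ← lintegral_add_right]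
  · congr 1
    exact lintegral_congr fun ω => (ENNReal.ofReal_add
      (IsPSDForm.dotProduct_self.nonneg _) (hq.nonneg _)).symm
  · exact (hq.measurable.comp (measurable_Zpred hg ht fun s _ =>
      measurable_clm hnoise _)).ennreal_ofReal

/-- Verification of the value functions `q k` (`k` remaining steps) against an arbitrary strategy:
the expected cost of the last `k` steps is bounded below by the expected value at the prediction,
up to strategy-independent terms. For `k = 0` the prediction is one for a time beyond the horizon,
which is harmless because `q 0 = 0`. -/
theorem value_le {q : ℕ → (Fin m.dx → ℝ) → ℝ} (hq : ∀ k, IsPSDForm (q k)) (hq0 : ∀ z, q 0 z = 0)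
    (hle : ∀ k z u, q (k + 1) z ≤
      (m.M *ᵥ z + m.N *ᵥ u) ⬝ᵥ (m.M *ᵥ z + m.N *ᵥ u) + q k (m.A *ᵥ z + m.B *ᵥ u))
    {k : ℕ} (hk : k ≤ m.T) :
    ∫⁻ ω, ENNReal.ofReal (q k (Zpred X₁ W V g (m.T - k) ω)) ∂P +
      ∑ j ∈ Finset.range k, fixedCost P X₁ W V (q (j + 1)) (m.T - 1 - j) ≤
    ∑ j ∈ Finset.range k, ∫⁻ ω, ENNReal.ofReal
      ((m.M *ᵥ m.X X₁ W V g (m.T - 1 - j) ω + m.N *ᵥ m.U X₁ W V g (m.T - 1 - j) ω) ⬝ᵥ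
        (m.M *ᵥ m.X X₁ W V g (m.T - 1 - j) ω + m.N *ᵥ m.U X₁ W V g (m.T - 1 - j) ω)) ∂P := by
  induction k with
  | zero => simp [hq0]
  | succ k ih =>
    obtain ⟨t, ht, e1, e2, e3⟩ : ∃ t < m.T, m.T - k = t + 1 ∧ m.T - (k + 1) = t ∧ m.T - 1 - k = t :=
      ⟨m.T - (k + 1), by omega, by omega, rfl, by omega⟩
    have ih' := ih (by omega)
    rw [e1] at ih'
    rw [Finset.sum_range_succ, Finset.sum_range_succ, e2, e3]
    refine le_trans ?_ (add_le_add_left ih' _)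
    rw [add_right_comm _ (Finset.sum _ _), add_comm (∫⁻ ω, ENNReal.ofReal (q k _) ∂P),
      lintegral_stage_add hnoise hg hinv (hq k) ht]
    have h1 : ∫⁻ ω, ENNReal.ofReal (q (k + 1) (Zc X₁ W V g t ω)) ∂P ≤ _ :=
      lintegral_mono fun ω => ENNReal.ofReal_le_ofReal (hle k _ (m.U X₁ W V g t ω))
    rw [lintegral_Zc hnoise hg hinv (hq _) ht] at h1
    refine le_trans (le_of_eq ?_) (add_le_add_left (add_le_add_left h1 _) _)
    rw [fixedCost]
    abel

/-- The lower bound `value_le` is attained by the optimal gains. -/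
theorem value_eq {q : ℕ → (Fin m.dx → ℝ) → ℝ} (hq : ∀ k, IsPSDForm (q k)) (hq0 : ∀ z, q 0 z = 0)
    {K : ℕ → Matrix (Σ i, Fin (m.du i)) (Fin m.dx) ℝ}
    (heq : ∀ k z, q (k + 1) z = (m.M *ᵥ z + m.N *ᵥ (K k *ᵥ z)) ⬝ᵥ
      (m.M *ᵥ z + m.N *ᵥ (K k *ᵥ z)) + q k (m.A *ᵥ z + m.B *ᵥ (K k *ᵥ z)))
    (hU : ∀ k < m.T, ∀ ω, m.U X₁ W V g (m.T - 1 - k) ω = K k *ᵥ Zc X₁ W V g (m.T - 1 - k) ω)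
    {k : ℕ} (hk : k ≤ m.T) :
    ∑ j ∈ Finset.range k, ∫⁻ ω, ENNReal.ofReal
      ((m.M *ᵥ m.X X₁ W V g (m.T - 1 - j) ω + m.N *ᵥ m.U X₁ W V g (m.T - 1 - j) ω) ⬝ᵥ
        (m.M *ᵥ m.X X₁ W V g (m.T - 1 - j) ω + m.N *ᵥ m.U X₁ W V g (m.T - 1 - j) ω)) ∂P =
    ∫⁻ ω, ENNReal.ofReal (q k (Zpred X₁ W V g (m.T - k) ω)) ∂P +
      ∑ j ∈ Finset.range k, fixedCost P X₁ W V (q (j + 1)) (m.T - 1 - j) := by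
  induction k with
  | zero => simp [hq0]
  | succ k ih =>
    obtain ⟨t, ht, e1, e2, e3⟩ : ∃ t < m.T, m.T - k = t + 1 ∧ m.T - (k + 1) = t ∧ m.T - 1 - k = t :=
      ⟨m.T - (k + 1), by omega, by omega, rfl, by omega⟩
    have hU' := hU k hk
    have ih' := ih (by omega)
    rw [e3] at hU'
    rw [e1] at ih'
    rw [Finset.sum_range_succ, Finset.sum_range_succ, e2, e3, ih', add_right_comm,
      add_comm (∫⁻ ω, ENNReal.ofReal (q k _) ∂P), lintegral_stage_add hnoise hg hinv (hq k) ht]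
    simp only [hU', ← heq]
    rw [lintegral_Zc hnoise hg hinv (hq _) ht, fixedCost]
    abel

end Probability

/-! ### Optimality and conditional expectation -/

section Optimality

variable {Ω : Type*} [MeasurableSpace Ω] {P : Measure Ω} [IsProbabilityMeasure P]
  {X₁ : Ω → Fin m.dx → ℝ} {W : ℕ → Ω → Fin m.dx → ℝ}
  {V : ℕ → Ω → (Σ i, Fin (m.dy i)) → ℝ}

/-- The gains of the Riccati recursion, read backwards in time, are optimal. -/
theorem exists_isOptimal_centralStrategy (hinv : ∀ t < m.T, IsUnit (m.innovCov (m.predCov t)))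
    (hnoise : m.IsNoise X₁ W V P) :
    ∃ K : m.Gains, m.IsOptimal X₁ W V (m.centralStrategy K) P m.centralInfo := by
  obtain ⟨q, K, hq, hq0, hle, heq⟩ := exists_riccati m.A m.B m.M m.N
  refine ⟨fun t => K (m.T - 1 - t), admissible_centralStrategy _, fun g' hg' => ?_⟩
  have hg : ∀ i, ∀ t < m.T, Measurable (m.centralStrategy (fun t => K (m.T - 1 - t)) i t) :=
    fun i t ht => (admissible_centralStrategy _ i t ht).1
  have hg'm : ∀ i, ∀ t < m.T, Measurable (g' i t) := fun i t ht => (hg' i t ht).1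
  rw [cost_eq_sum hnoise hg, cost_eq_sum hnoise hg'm]
  -- both expected values at time `0` are `q T 0`, as the initial prediction vanishes
  have h0 : ∀ g : m.Strategy, Zpred X₁ W V g (m.T - m.T) = fun _ => 0 := fun g => by
    rw [Nat.sub_self]
    rfl
  have h1 := value_le hnoise hg'm hinv hq hq0 hle le_rfl
  rw [h0] at h1
  refine le_trans (le_of_eq ?_) h1
  have h2 := value_eq hnoise hg hinv hq hq0 heq (fun k hk ω => ?_) le_rfl
  · rw [h0] at h2
    exact h2
  · have : m.T - 1 - (m.T - 1 - k) = k := by omega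
    simp only [U, centralStrategy, Zc, this]
    rfl

/-- Under a linear strategy the estimate is integrable. -/
theorem integrable_Zc_centralStrategy (hnoise : m.IsNoise X₁ W V P) (K : m.Gains) {t : ℕ}
    (ht : t < m.T) : Integrable (Zc X₁ W V (m.centralStrategy K) t) P := by
  have key : Integrable (Zpred X₁ W V (m.centralStrategy K) t) P →
      Integrable (Zc X₁ W V (m.centralStrategy K) t) P := by
    intro h
    rw [show Zc X₁ W V (m.centralStrategy K) t = _ from funext fun ω => Zc_eq_Zpred_add ht ω]
    exact h.add (integrable_clm hnoise ((m.L t).mulVecCLM.comp (m.innov t)))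
  induction t with
  | zero => exact key (integrable_const _)
  | succ t ih =>
    have hZ := ih (by omega) fun h => by
      rw [show Zc X₁ W V (m.centralStrategy K) t = _ from
        funext fun ω => Zc_eq_Zpred_add (by omega) ω]
      exact h.add (integrable_clm hnoise ((m.L t).mulVecCLM.comp (m.innov t)))
    exact key ((m.A.mulVecCLM.integrable_comp hZ).add
      (m.B.mulVecCLM.integrable_comp ((K t).mulVecCLM.integrable_comp hZ)))

theorem condExp_X_centralStrategy (hinv : ∀ t < m.T, IsUnit (m.innovCov (m.predCov t)))
    (hnoise : m.IsNoise X₁ W V P) (K : m.Gains) {t : ℕ} (ht : t < m.T) :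
    P[m.X X₁ W V (m.centralStrategy K) t | m.centralSigma X₁ W V (m.centralStrategy K) t]
      =ᵐ[P] fun ω => m.Z (m.record X₁ W V (m.centralStrategy K) t ω) t := by
  set g := m.centralStrategy K with hgdef
  have hg : ∀ i, ∀ t < m.T, Measurable (g i t) :=
    fun i t ht => (admissible_centralStrategy K i t ht).1
  have hrec := measurable_record_of_isNoise hnoise hg ht
  have hle : m.centralSigma X₁ W V g t ≤
      MeasurableSpace.comap (m.record X₁ W V g t) inferInstance :=
    iSup₂_le fun ℓ _ => by
      have h : Measurable fun ρ : m.Record => ρ ℓ := measurable_pi_apply ℓ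
      exact (h.comp (comap_measurable (m.record X₁ W V g t))).comap_le
  have hle' := hle.trans hrec.comap_le
  have hZ : Measurable[m.centralSigma X₁ W V g t] (Zc X₁ W V g t) :=
    @measurable_Z_of_forall m Ω (m.centralSigma X₁ W V g t) (m.record X₁ W V g t) t fun ℓ hℓ =>
      (comap_measurable _).mono (le_iSup₂_of_le ℓ hℓ le_rfl) le_rfl
  have hZi : Integrable (Zc X₁ W V g t) P := integrable_Zc_centralStrategy hnoise K ht
  have he := integrable_clm hnoise (m.filtErr t)
  have hind : P[fun ω => m.filtErr t (primNoise X₁ W V ω) | m.centralSigma X₁ W V g t]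
      =ᵐ[P] fun _ => 0 := by
    have h := (indepFun_record_filtErr hnoise hg hinv ht).symm
    rw [IndepFun_iff_Indep] at h
    have h2 := condExp_indep_eq (measurable_clm hnoise (m.filtErr t)).comap_le hle'
      (comap_measurable _).stronglyMeasurable (indep_of_indep_of_le_right h hle)
    rw [integral_clm_primNoise hnoise (m.filtErr t)] at h2
    exact h2
  have hX : m.X X₁ W V g t = Zc X₁ W V g t + fun ω => m.filtErr t (primNoise X₁ W V ω) :=
    funext fun ω => X_eq_Zc_add ht ω
  rw [hX]
  filter_upwards [condExp_add hZi he (m.centralSigma X₁ W V g t), hind] with ω h1 h2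
  rw [h1, Pi.add_apply, h2, condExp_of_stronglyMeasurable hle' hZ.stronglyMeasurable hZi, add_zero]
  rfl

omit [IsProbabilityMeasure P] in
/-- The decentralized profile costs as much as the centralized one, which bounds from below the cost
of every profile admissible for `I`. -/
theorem isOptimal_localStrategy (hsub : m.Substitutable) {I : m.InfoStructure}
    (hI : ∀ i, ∀ t < m.T, m.ownInfo i t ⊆ I i t ∧ I i t ⊆ m.centralInfo i t) {K : m.Gains}
    (hK : m.IsOptimal X₁ W V (m.centralStrategy K) P m.centralInfo) :
    m.IsOptimal X₁ W V (m.localStrategy K) P I ∧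
      m.cost X₁ W V (m.localStrategy K) P = m.cost X₁ W V (m.centralStrategy K) P := by
  have hc : m.cost X₁ W V (m.localStrategy K) P = m.cost X₁ W V (m.centralStrategy K) P := by
    simp only [cost, (localStrategy_eq hsub K _ _).1, (localStrategy_eq hsub K _ _).2]
  refine ⟨⟨admissible_localStrategy (fun i t ht => (hI i t ht).1) K, fun g' hg' => ?_⟩, hc⟩
  rw [hc]
  exact hK.2 g' fun i t ht => ⟨(hg' i t ht).1, fun ρ ρ' h =>
    (hg' i t ht).2 fun ℓ hℓ => h ℓ ((hI i t ht).2 hℓ)⟩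

end Optimality

end LQGModel

theorem corollary2 (m : LQGModel) (hsub : m.Substitutable)
    (hinv : ∀ t < m.T, IsUnit (m.innovCov (m.predCov t)))
    {Ω : Type*} [MeasurableSpace Ω] (P : Measure Ω) [IsProbabilityMeasure P]
    (X₁ : Ω → Fin m.dx → ℝ) (W : ℕ → Ω → Fin m.dx → ℝ)
    (V : ℕ → Ω → (Σ i, Fin (m.dy i)) → ℝ) (hnoise : m.IsNoise X₁ W V P)
    (I : m.InfoStructure)
    (hI : ∀ i, ∀ t < m.T, m.ownInfo i t ⊆ I i t ∧ I i t ⊆ m.centralInfo i t) :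
    (∃ K : m.Gains, m.IsOptimal X₁ W V (m.centralStrategy K) P m.centralInfo) ∧
    (∀ K : m.Gains, ∀ t < m.T,
      P[m.X X₁ W V (m.centralStrategy K) t | m.centralSigma X₁ W V (m.centralStrategy K) t]
        =ᵐ[P] fun ω => m.Z (m.record X₁ W V (m.centralStrategy K) t ω) t) ∧
    (∀ K : m.Gains, m.IsOptimal X₁ W V (m.centralStrategy K) P m.centralInfo →
      m.IsOptimal X₁ W V (m.localStrategy K) P I ∧
      m.cost X₁ W V (m.localStrategy K) P = m.cost X₁ W V (m.centralStrategy K) P) := by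
  exact ⟨LQGModel.exists_isOptimal_centralStrategy hinv hnoise,
    fun K _ ht => LQGModel.condExp_X_centralStrategy hinv hnoise K ht,
    fun _ hK => LQGModel.isOptimal_localStrategy hsub hI hK⟩
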